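/- **Setting.** Let $\mathbb{V}^{n_1\times n_2}$ be one of $\mathbb{R}^{n_1\times n_2}$, $\mathbb{C}^{n_1\times n_2}$, the real symmetric $n\times n$ matrices, or the Hermitian $n\times n$ matrices ($n_1=n_2=n$ in the last two cases), with the real inner product $\langle X,Y\rangle=\mathrm{Re}\,\mathrm{Tr}(X^{\mathbb T}Y)$ and Frobenius norm $\|\cdot\|_F$, where $^{\mathbb T}$ is the transpose in the real case and the conjugate transpose in the complex case. $\|\cdot\|$ is the spectral norm, $\|\cdot\|_*$ the nuclear norm, and $\sigma(X)\in\mathbb{R}^{\min(n_1,n_2)}$ the vector of singular values of $X$ in nonincreasing order. Let $\Theta_1,\dots,\Theta_d$ be an orthonormal basis of $\mathbb{V}^{n_1\times n_2}$, let $\alpha\subseteq\{1,\dots,d\}$ with complement $\beta$, and let $\overline X\in\mathbb{V}^{n_1\times n_2}$ have rank $r\ge1$. The sizes $n_1,n_2$ are fixed. *Observations.* $y_i=\langle\Theta_{\omega_i},\overline X\rangle+\nu\xi_i$, $i=1,2,\dots$, with $\nu>0$, where the $\omega_i$ are i.i.d. with $\Pr(\omega_i=k)=p_k$, $p_k=0$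 for $k\in\alpha$ and $p_k>0$ for $k\in\beta$; the $\xi_i$ are i.i.d. real random variables with $\mathbb{E}\xi_i=0$, $\mathbb{E}\xi_i^2=1$; and the noise $(\xi_i)$ is independent of the sampling $(\omega_i)$. Put $\mathcal{Q}_\beta^\dagger(X)=\sum_{k\in\beta}\frac1{p_k}\langle\Theta_k,X\rangle\Theta_k$. *Spectral operator.* Let $f:\mathbb{R}^{\min(n_1,n_2)}\to\mathbb{R}^{\min(n_1,n_2)}$ be symmetric, i.e. $f(x)=Q^{\mathbb T}f(Qx)$ for every signed permutation matrix $Q$ and every $x$, and let $F(X)=U\,\mathrm{Diag}(f(\sigma(X)))V^{\mathbb T}$ for any singular value decomposition $X=U\,\mathrm{Diag}(\sigma(X))V^{\mathbb T}$ with $U,V$ orthogonal (unitary). Assume that $F:\mathbb{V}^{n_1\times n_2}\to\mathbb{V}^{n_1\times n_2}$ is continuous at $\overline X$. *Estimator.* Let $\widetilde X_m\in\mathbb{V}^{n_1\times n_2}$ be random matrices (initial estimators) with $\widetilde X_m\to\overline X$ in probability, let $\rho_m>0$ be deterministic and $\gamma_m\ge0$ possibly random, and for each $m\ge1$ let $\widehat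 X_m$ be an optimal solution of $$\min_{X\in\mathbb{V}^{n_1\times n_2}}\ \frac1{2m}\sum_{i=1}^m\big(y_i-\langle\Theta_{\omega_i},X\rangle\big)^2+\rho_m\Big(\|X\|_*-\langle F(\widetilde X_m),X\rangle+\frac{\gamma_m}2\|X-\widetilde X_m\|_F^2\Big)$$ subject to $\langle\Theta_k,X\rangle=\langle\Theta_k,\overline X\rangle$ for all $k\in\alpha$. **Theorem 4.1.** Suppose that $\rho_m\to0$, $\sqrt m\,\rho_m\to\infty$ and $\gamma_m=O_p(1)$ (bounded in probability). If $\widehat X_m$ is rank consistent, i.e. $\lim_{m\to\infty}\Pr\big(\mathrm{rank}(\widehat X_m)=\mathrm{rank}(\overline X)\big)=1$, then for every singular value decomposition $\overline X=\overline U\,\mathrm{Diag}(\sigma(\overline X))\,\overline V^{\mathbb T}$, with $\overline U=[\overline U_1\ \overline U_2]$ and $\overline V=[\overline V_1\ \overline V_2]$ split after the first $r$ columns, the linear system $$\overline U_2^{\mathbb T}\mathcal{Q}_\beta^\dagger\big(\overline U_2\Gamma\overline V_2^{\mathbb T}\big)\overline V_2=\overline U_2^{\mathbb T}\mathcal{Q}_\beta^\dagger\big(\overline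 U_1\overline V_1^{\mathbb T}-F(\overline X)\big)\overline V_2$$ has a solution $\widehat\Gamma\in\mathbb{V}^{(n_1-r)\times(n_2-r)}$ with $\|\widehat\Gamma\|\le1$. Here $\mathbb{V}^{(n_1-r)\times(n_2-r)}$ is the space of all $(n_1-r)\times(n_2-r)$ matrices $\Gamma$ over the same field with $\overline U_2\Gamma\overline V_2^{\mathbb T}\in\mathbb{V}^{n_1\times n_2}$: all real (complex) matrices if $\mathbb{V}^{n_1\times n_2}$ is $\mathbb{R}^{n_1\times n_2}$ ($\mathbb{C}^{n_1\times n_2}$), and, in the real symmetric (Hermitian) case with $\overline U_2=\overline V_2$, the real symmetric (Hermitian) matrices. -/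

import Mathlib

open MeasureTheory ProbabilityTheory Filter Topology
open scoped Matrix

namespace RankCorrection

/-! ### Matrix spaces

The scalars are an arbitrary `RCLike` field `𝕜`, i.e. the reals or the complex numbers, and `Xᴴ` is
the transpose in the real case and the conjugate transpose in the complex case. -/

/-- The two kinds of matrix spaces over `𝕜`: all `n₁ × n₂` matrices, or the self-adjoint `n × n`
matrices (real symmetric for `𝕜 = ℝ`, Hermitian for `𝕜 = ℂ`). -/
inductive MatrixSpace : ℕ → ℕ → Type
  | full (n₁ n₂ : ℕ) : MatrixSpace n₁ n₂
  | selfAdj (n : ℕ) : MatrixSpace n n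

section

variable {𝕜 : Type*} [RCLike 𝕜] {n₁ n₂ d : ℕ}

/-- The real vector space of matrices `𝕍^{n₁ × n₂}` of the given kind. -/
noncomputable def MatrixSpace.toSubmodule (𝕜 : Type*) [RCLike 𝕜] :
    {n₁ n₂ : ℕ} → MatrixSpace n₁ n₂ → Submodule ℝ (Matrix (Fin n₁) (Fin n₂) 𝕜)
  | _, _, .full _ _ => ⊤
  | _, _, .selfAdj n => selfAdjoint.submodule ℝ (Matrix (Fin n) (Fin n) 𝕜)

/-- The trace inner product `⟨X, Y⟩ = Re tr (Xᴴ Y)`. -/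
noncomputable def trInner (X Y : Matrix (Fin n₁) (Fin n₂) 𝕜) : ℝ :=
  RCLike.re (Xᴴ * Y).trace

/-- The Frobenius norm, induced by the trace inner product. -/
noncomputable def frobNorm (X : Matrix (Fin n₁) (Fin n₂) 𝕜) : ℝ :=
  Real.sqrt (trInner X X)

/-- The spectral norm: the operator norm between Euclidean spaces. -/
noncomputable def specNorm (X : Matrix (Fin n₁) (Fin n₂) 𝕜) : ℝ :=
  ‖LinearMap.toContinuousLinearMap (Matrix.toEuclideanLin X)‖

/-- The vector of the `min n₁ n₂` singular values in nonincreasing order. -/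
noncomputable def singVals (X : Matrix (Fin n₁) (Fin n₂) 𝕜) : Fin (min n₁ n₂) → ℝ :=
  fun i => (Matrix.toEuclideanLin X).singularValues i

/-- The nuclear norm: the sum of the singular values. -/
noncomputable def nucNorm (X : Matrix (Fin n₁) (Fin n₂) 𝕜) : ℝ :=
  ∑ i, singVals X i

/-- The rectangular `n₁ × n₂` diagonal matrix with diagonal `x`. -/
def rectDiag (𝕜 : Type*) [RCLike 𝕜] {n₁ n₂ : ℕ} (x : Fin (min n₁ n₂) → ℝ) :
    Matrix (Fin n₁) (Fin n₂) 𝕜 :=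
  Matrix.of fun i j =>
    if h : (i : ℕ) = (j : ℕ) then
      ((x ⟨i, lt_min i.isLt (h ▸ j.isLt)⟩ : ℝ) : 𝕜)
    else 0

/-- `(U, V)` is a pair of orthogonal (unitary) matrices with `X = U Diag(σ(X)) Vᴴ`. -/
def IsSVD (X : Matrix (Fin n₁) (Fin n₂) 𝕜)
    (U : Matrix (Fin n₁) (Fin n₁) 𝕜) (V : Matrix (Fin n₂) (Fin n₂) 𝕜) : Prop :=
  U ∈ Matrix.unitaryGroup (Fin n₁) 𝕜 ∧ V ∈ Matrix.unitaryGroup (Fin n₂) 𝕜 ∧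
    X = U * rectDiag 𝕜 (singVals X) * Vᴴ

/-- The first `r` columns of a square matrix. -/
def firstCols {n r : ℕ} (h : r ≤ n) (U : Matrix (Fin n) (Fin n) 𝕜) : Matrix (Fin n) (Fin r) 𝕜 :=
  U.submatrix id (Fin.castLE h)

/-- The last `n - r` columns of a square matrix. -/
def lastCols {n : ℕ} (r : ℕ) (U : Matrix (Fin n) (Fin n) 𝕜) : Matrix (Fin n) (Fin (n - r)) 𝕜 :=
  U.submatrix id fun i => ⟨r + i, by omega⟩

/-- The product `U₁ V₁ᴴ` of the first `rank X` columns of `U` and of `V`. -/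
noncomputable def leadingPart (X : Matrix (Fin n₁) (Fin n₂) 𝕜)
    (U : Matrix (Fin n₁) (Fin n₁) 𝕜) (V : Matrix (Fin n₂) (Fin n₂) 𝕜) :
    Matrix (Fin n₁) (Fin n₂) 𝕜 :=
  firstCols X.rank_le_height U * (firstCols X.rank_le_width V)ᴴ

/-- The space `𝕍^{(n₁ - r) × (n₂ - r)}`, relative to the matrices `U₂`, `V₂` of the last columns of
`U`, `V`: those `Γ` for which `U₂ Γ V₂ᴴ` lies in `𝕍^{n₁ × n₂}`. It consists of all matrices when
`𝕍` does, and of the self-adjoint ones when `𝕍` does and `U₂ = V₂`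
(see `mem_reducedSpace_full` and `mem_reducedSpace_selfAdj`). -/
def MatrixSpace.reducedSpace (S : MatrixSpace n₁ n₂) (r : ℕ)
    (U : Matrix (Fin n₁) (Fin n₁) 𝕜) (V : Matrix (Fin n₂) (Fin n₂) 𝕜) :
    Set (Matrix (Fin (n₁ - r)) (Fin (n₂ - r)) 𝕜) :=
  {Γ | lastCols r U * Γ * (lastCols r V)ᴴ ∈ S.toSubmodule 𝕜}

/-! ### Spectral operators -/

/-- A signed permutation matrix: exactly one nonzero entry, equal to `1` or `-1`, in each row and
in each column. -/
def IsSignedPermutation {n : ℕ} (Q : Matrix (Fin n) (Fin n) ℝ) : Prop :=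
  (∀ i j, Q i j = 0 ∨ Q i j = 1 ∨ Q i j = -1) ∧
    (∀ i, ∃! j, Q i j ≠ 0) ∧ (∀ j, ∃! i, Q i j ≠ 0)

/-- `f` is symmetric: `f x = Qᵀ f (Q x)` for all signed permutation matrices `Q` and all `x`. -/
def IsSymmetricFun {n : ℕ} (f : (Fin n → ℝ) → (Fin n → ℝ)) : Prop :=
  ∀ Q : Matrix (Fin n) (Fin n) ℝ, IsSignedPermutation Q → ∀ x, f x = Qᵀ *ᵥ f (Q *ᵥ x)

open Classical in
/-- The spectral operator of `f`: `F(X) = U Diag(f(σ(X))) Vᴴ` for a singular value decomposition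
`(U, V)` of `X` (for symmetric `f` the value does not depend on its choice). -/
noncomputable def spectralOperator (f : (Fin (min n₁ n₂) → ℝ) → (Fin (min n₁ n₂) → ℝ))
    (X : Matrix (Fin n₁) (Fin n₂) 𝕜) : Matrix (Fin n₁) (Fin n₂) 𝕜 :=
  if h : ∃ W : Matrix (Fin n₁) (Fin n₁) 𝕜 × Matrix (Fin n₂) (Fin n₂) 𝕜, IsSVD X W.1 W.2 then
    h.choose.1 * rectDiag 𝕜 (f (singVals X)) * (h.choose.2)ᴴ
  else 0

/-! ### The rank-correction step -/

/-- `Θ₁, …, Θ_d` is an orthonormal basis of the real inner product space `𝕍`. -/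
structure IsOrthonormalBasisOf (𝕍 : Submodule ℝ (Matrix (Fin n₁) (Fin n₂) 𝕜))
    (Θ : Fin d → Matrix (Fin n₁) (Fin n₂) 𝕜) : Prop where
  orthonormal : ∀ k l, trInner (Θ k) (Θ l) = if k = l then 1 else 0
  span_eq : Submodule.span ℝ (Set.range Θ) = 𝕍

/-- The operator `𝒬_β^†(X) = ∑_{k ∈ β} (1 / p_k) ⟨Θ_k, X⟩ Θ_k`. -/
noncomputable def Qdagger (Θ : Fin d → Matrix (Fin n₁) (Fin n₂) 𝕜) (p : Fin d → ℝ)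
    (β : Finset (Fin d)) (X : Matrix (Fin n₁) (Fin n₂) 𝕜) : Matrix (Fin n₁) (Fin n₂) 𝕜 :=
  ∑ k ∈ β, (1 / p k * trInner (Θ k) X) • Θ k

/-- The objective function of the rank-correction step, for the sampled indices `idx 0, …,
idx (m - 1)`, the observations `y 0, …, y (m - 1)`, the parameters `ρ`, `γ`, the initial estimator
`Xtil`, and the matrix `G`, which is the spectral operator at `Xtil`. -/
noncomputable def rcsObjective (Θ : Fin d → Matrix (Fin n₁) (Fin n₂) 𝕜) (m : ℕ)
    (idx : ℕ → Fin d) (y : ℕ → ℝ) (ρ γ : ℝ) (G Xtil X : Matrix (Fin n₁) (Fin n₂) 𝕜) : ℝ :=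
  1 / (2 * m) * ∑ i ∈ Finset.range m, (y i - trInner (Θ (idx i)) X) ^ 2 +
    ρ * (nucNorm X - trInner G X + γ / 2 * frobNorm (X - Xtil) ^ 2)

/-- The feasible set of the rank-correction step: the matrices in `𝕍` whose basis coefficients with
indices in `α` are those of `Xbar`. -/
def rcsFeasible (𝕍 : Submodule ℝ (Matrix (Fin n₁) (Fin n₂) 𝕜))
    (Θ : Fin d → Matrix (Fin n₁) (Fin n₂) 𝕜) (α : Finset (Fin d))
    (Xbar : Matrix (Fin n₁) (Fin n₂) 𝕜) : Set (Matrix (Fin n₁) (Fin n₂) 𝕜) :=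
  {X | X ∈ 𝕍 ∧ ∀ k ∈ α, trInner (Θ k) X = trInner (Θ k) Xbar}

/-! ### Asymptotic notions -/

/-- `x_m = O_p(1)`: the sequence is bounded in probability. -/
def BoundedInProbability {Ω : Type*} [MeasurableSpace Ω] (P : Measure Ω) (x : ℕ → Ω → ℝ) : Prop :=
  ∀ ε : ℝ, 0 < ε → ∃ M : ℝ, ∀ᶠ m in atTop, P {ω | M < |x m ω|} ≤ ENNReal.ofReal ε

/-- `X_m → Xbar` in probability. -/
def TendstoInProbability {Ω : Type*} [MeasurableSpace Ω] (P : Measure Ω)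
    (X : ℕ → Ω → Matrix (Fin n₁) (Fin n₂) 𝕜) (Xbar : Matrix (Fin n₁) (Fin n₂) 𝕜) : Prop :=
  ∀ ε : ℝ, 0 < ε → Tendsto (fun m => P {ω | ε ≤ frobNorm (X m ω - Xbar)}) atTop (𝓝 0)

/-- `X_m` is a rank consistent estimator of `Xbar`: `Pr (rank X_m = rank Xbar) → 1`. -/
def RankConsistent {Ω : Type*} [MeasurableSpace Ω] (P : Measure Ω)
    (X : ℕ → Ω → Matrix (Fin n₁) (Fin n₂) 𝕜) (Xbar : Matrix (Fin n₁) (Fin n₂) 𝕜) : Prop :=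
  Tendsto (fun m => P {ω | (X m ω).rank = Xbar.rank}) atTop (𝓝 1)

/-! ### The reduced matrix space in the standard cases -/

theorem mem_reducedSpace_full (r : ℕ) (U : Matrix (Fin n₁) (Fin n₁) 𝕜)
    (V : Matrix (Fin n₂) (Fin n₂) 𝕜) (Γ : Matrix (Fin (n₁ - r)) (Fin (n₂ - r)) 𝕜) :
    Γ ∈ (MatrixSpace.full n₁ n₂).reducedSpace r U V :=
  Submodule.mem_top (R := ℝ) (M := Matrix (Fin n₁) (Fin n₂) 𝕜)
    (x := lastCols r U * Γ * (lastCols r V)ᴴ)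

theorem lastCols_conjTranspose_mul_self {n : ℕ} (r : ℕ) {U : Matrix (Fin n) (Fin n) 𝕜}
    (hU : U ∈ Matrix.unitaryGroup (Fin n) 𝕜) : (lastCols r U)ᴴ * lastCols r U = 1 := by
  have h : Uᴴ * U = 1 := Matrix.mem_unitaryGroup_iff'.mp hU
  ext i j
  have hij := congrFun (congrFun h ⟨r + i, by omega⟩) ⟨r + j, by omega⟩
  simp only [Matrix.mul_apply, Matrix.conjTranspose_apply, Matrix.one_apply, Fin.mk.injEq,
    Nat.add_left_cancel_iff] at hij
  simp only [lastCols, Matrix.mul_apply, Matrix.conjTranspose_apply, Matrix.submatrix_apply, id,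
    Matrix.one_apply, hij, Fin.ext_iff]

theorem mem_reducedSpace_selfAdj {n : ℕ} (r : ℕ) {U V : Matrix (Fin n) (Fin n) 𝕜}
    (hU : U ∈ Matrix.unitaryGroup (Fin n) 𝕜) (hUV : lastCols r U = lastCols r V)
    (Γ : Matrix (Fin (n - r)) (Fin (n - r)) 𝕜) :
    Γ ∈ (MatrixSpace.selfAdj n).reducedSpace r U V ↔ Γ.IsHermitian := by
  have h1 := lastCols_conjTranspose_mul_self r hU
  change (lastCols r U * Γ * (lastCols r V)ᴴ)ᴴ = lastCols r U * Γ * (lastCols r V)ᴴ ↔ Γᴴ = Γ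
  rw [← hUV]
  simp only [Matrix.conjTranspose_mul, Matrix.conjTranspose_conjTranspose]
  constructor
  · intro h
    have h2 := congrArg (fun A => (lastCols r U)ᴴ * A * lastCols r U) h
    simpa only [Matrix.mul_assoc, h1, Matrix.mul_one, ← Matrix.mul_assoc (lastCols r U)ᴴ,
      Matrix.one_mul] using h2
  · intro h
    rw [h, Matrix.mul_assoc]

end

end RankCorrection

open RankCorrection

namespace RankCorrection

section

variable {𝕜 : Type*} [RCLike 𝕜] {n₁ n₂ : ℕ}

/-! ### The trace inner product -/

/-! Write `r` for the rank of `Xbar` and `D = (Xhat - Xbar) / ρ` for the rescaled error. Optimality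
yields a subgradient `W` of the nuclear norm at `Xhat` which, tested against `Θ k` with `k ∉ α`,
says that (frequency of `k` + `ργ`) times the `k`-th coordinate of `D` equals a noise term plus the
`k`-th coordinate of `F(Xtil) - W`, up to a multiple of `Xtil - Xbar`
(`exists_subgradient_coordinates`). By Chebyshev, frequencies tend to `p k`, and the noise term
tends to zero because `√m ρ → ∞` (`tendsto_frequency`, `tendsto_noise`). Contractions form a compact
set, so `W` has a limit `W₀`. Hence `D` tends to `𝒬†(F(Xbar) - W₀)`, `Xhat` tends to `Xbar`, and
`W₀` is a subgradient at `Xbar`.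

Two facts about this limit give the system. If `Xbar + ρ D` has rank `r` while `ρ → 0`, the limit of
`D` is tangent to the rank-`r` matrices, i.e. its `U₂, V₂` block vanishes
(`block_eq_zero_of_rank_le`). And a subgradient at `Xbar` has the form `U₁V₁ᴴ + U₂Γ₀V₂ᴴ` with `Γ₀` a
contraction (`subgradient_eq_leadingPart_add`). Substituting the second in the first shows that `Γ =
-Γ₀` solves the system.

The conclusion is deterministic, so no limit law is needed: one sequence of outcomes along which
rank equality, optimality and all approximations hold is enough. Such outcomes exist because the
relevant events cannot exclude each other (`frequently_exists_mem`), and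
`exists_contraction_of_tendsto` is then applied to this sequence. -/

theorem trInner_eq_sum (X Y : Matrix (Fin n₁) (Fin n₂) 𝕜) :
    trInner X Y = ∑ i, ∑ j, RCLike.re (star (X i j) * Y i j) := by
  simp only [trInner, Matrix.trace, Matrix.diag, Matrix.mul_apply, Matrix.conjTranspose_apply,
    map_sum]
  exact Finset.sum_comm

theorem trInner_comm (X Y : Matrix (Fin n₁) (Fin n₂) 𝕜) : trInner X Y = trInner Y X := by
  simp only [trInner_eq_sum, RCLike.star_def, RCLike.mul_re, RCLike.conj_re, RCLike.conj_im]
  exact Finset.sum_congr rfl fun i _ => Finset.sum_congr rfl fun j _ => by ring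

theorem trInner_add_right (X Y Z : Matrix (Fin n₁) (Fin n₂) 𝕜) :
    trInner X (Y + Z) = trInner X Y + trInner X Z := by
  simp [trInner, Matrix.mul_add]

theorem trInner_smul_right (c : ℝ) (X Y : Matrix (Fin n₁) (Fin n₂) 𝕜) :
    trInner X (c • Y) = c * trInner X Y := by
  simp [trInner, RCLike.smul_re]

/-- The trace inner product with a fixed matrix, as a linear form. -/
noncomputable def trInnerLin (X : Matrix (Fin n₁) (Fin n₂) 𝕜) :
    Matrix (Fin n₁) (Fin n₂) 𝕜 →ₗ[ℝ] ℝ where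
  toFun := trInner X
  map_add' := trInner_add_right X
  map_smul' c Y := trInner_smul_right c X Y

@[simp]
theorem trInnerLin_apply (X Y : Matrix (Fin n₁) (Fin n₂) 𝕜) : trInnerLin X Y = trInner X Y := rfl

theorem trInner_add_left (X Y Z : Matrix (Fin n₁) (Fin n₂) 𝕜) :
    trInner (X + Y) Z = trInner X Z + trInner Y Z := by
  simp only [trInner_comm _ Z, trInner_add_right]

theorem trInner_smul_left (c : ℝ) (X Y : Matrix (Fin n₁) (Fin n₂) 𝕜) :
    trInner (c • X) Y = c * trInner X Y := by
  simp only [trInner_comm _ Y, trInner_smul_right]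

theorem trInner_sub_right (X Y Z : Matrix (Fin n₁) (Fin n₂) 𝕜) :
    trInner X (Y - Z) = trInner X Y - trInner X Z :=
  map_sub (trInnerLin X) Y Z

theorem trInner_sub_left (X Y Z : Matrix (Fin n₁) (Fin n₂) 𝕜) :
    trInner (X - Y) Z = trInner X Z - trInner Y Z := by
  simp only [trInner_comm _ Z, trInner_sub_right]

theorem trInner_conjTranspose (X Y : Matrix (Fin n₁) (Fin n₂) 𝕜) :
    trInner Xᴴ Yᴴ = trInner X Y := by
  simp only [trInner_eq_sum, Matrix.conjTranspose_apply]
  rw [Finset.sum_comm]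
  refine Finset.sum_congr rfl fun i _ => Finset.sum_congr rfl fun j _ => ?_
  simp only [RCLike.star_def, RCLike.mul_re, RCLike.conj_re, RCLike.conj_im]
  ring

theorem trInner_self_eq_sum (X : Matrix (Fin n₁) (Fin n₂) 𝕜) :
    trInner X X = ∑ i, ∑ j, ‖X i j‖ ^ 2 := by
  rw [trInner_eq_sum]
  refine Finset.sum_congr rfl fun i _ => Finset.sum_congr rfl fun j _ => ?_
  rw [RCLike.star_def, RCLike.conj_mul, ← RCLike.ofReal_pow, RCLike.ofReal_re]

theorem trInner_self_nonneg (X : Matrix (Fin n₁) (Fin n₂) 𝕜) : 0 ≤ trInner X X := by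
  rw [trInner_self_eq_sum]
  positivity

theorem frobNorm_sq (X : Matrix (Fin n₁) (Fin n₂) 𝕜) : frobNorm X ^ 2 = trInner X X :=
  Real.sq_sqrt (trInner_self_nonneg X)

theorem norm_entry_le_frobNorm (X : Matrix (Fin n₁) (Fin n₂) 𝕜) (i : Fin n₁) (j : Fin n₂) :
    ‖X i j‖ ≤ frobNorm X := by
  refine Real.le_sqrt_of_sq_le ?_
  rw [trInner_self_eq_sum]
  refine le_trans ?_ (Finset.single_le_sum (f := fun i => ∑ j, ‖X i j‖ ^ 2)
    (fun i _ => by positivity) (Finset.mem_univ i))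
  exact Finset.single_le_sum (f := fun j => ‖X i j‖ ^ 2) (fun j _ => by positivity)
    (Finset.mem_univ j)

/-- The trace can be computed in any orthonormal basis of the domain; the useful choice is a basis
of right singular vectors. -/
theorem trInner_eq_sum_inner (X Y : Matrix (Fin n₁) (Fin n₂) 𝕜)
    (b : OrthonormalBasis (Fin n₂) 𝕜 (EuclideanSpace 𝕜 (Fin n₂))) :
    trInner X Y =
      ∑ i, RCLike.re (inner 𝕜 (Matrix.toEuclideanLin X (b i)) (Matrix.toEuclideanLin Y (b i))) := by
  have h := LinearMap.trace_eq_sum_inner (Matrix.toEuclideanLin (Xᴴ * Y)) b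
  have h1 : LinearMap.trace 𝕜 _ (Matrix.toEuclideanLin (Xᴴ * Y)) = (Xᴴ * Y).trace := by
    rw [Matrix.toEuclideanLin, Matrix.toLpLin_eq_toLin, Matrix.trace_toLin_eq]
  rw [trInner, ← h1, h, map_sum]
  refine Finset.sum_congr rfl fun i _ => ?_
  rw [← LinearMap.adjoint_inner_right, ← Matrix.toEuclideanLin_conjTranspose_eq_adjoint]
  simp [Matrix.toLpLin_apply, Matrix.mulVec_mulVec]

/-! ### Contractions -/

theorem specNorm_le_one_iff (W : Matrix (Fin n₁) (Fin n₂) 𝕜) :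
    specNorm W ≤ 1 ↔ ∀ x, ‖Matrix.toEuclideanLin W x‖ ≤ ‖x‖ := by
  rw [specNorm, ContinuousLinearMap.opNorm_le_iff zero_le_one]
  simp

theorem specNorm_neg (W : Matrix (Fin n₁) (Fin n₂) 𝕜) : specNorm (-W) = specNorm W := by
  simp [specNorm]

theorem specNorm_conjTranspose_le_one {W : Matrix (Fin n₁) (Fin n₂) 𝕜} (hW : specNorm W ≤ 1) :
    specNorm Wᴴ ≤ 1 := by
  rw [specNorm_le_one_iff] at hW ⊢
  intro x
  -- Move one adjoint across: `‖Wᴴx‖² = ⟨x, W Wᴴ x⟩`, then Cauchy–Schwarz and the contraction bound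
  -- at `Wᴴx`.
  have h1 : ‖Matrix.toEuclideanLin Wᴴ x‖ ^ 2 ≤ ‖x‖ * ‖Matrix.toEuclideanLin Wᴴ x‖ := by
    rw [← inner_self_eq_norm_sq (𝕜 := 𝕜)]
    nth_rw 1 [Matrix.toEuclideanLin_conjTranspose_eq_adjoint]
    rw [LinearMap.adjoint_inner_left]
    refine (RCLike.re_le_norm _).trans ((norm_inner_le_norm _ _).trans ?_)
    exact mul_le_mul_of_nonneg_left (hW _) (norm_nonneg _)
  by_contra! h
  nlinarith [norm_nonneg x]

theorem specNorm_mul_le_one {n₃ : ℕ} {A : Matrix (Fin n₁) (Fin n₂) 𝕜}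
    {B : Matrix (Fin n₂) (Fin n₃) 𝕜} (hA : specNorm A ≤ 1) (hB : specNorm B ≤ 1) :
    specNorm (A * B) ≤ 1 := by
  rw [specNorm_le_one_iff] at *
  intro x
  have : Matrix.toEuclideanLin (A * B) x = Matrix.toEuclideanLin A (Matrix.toEuclideanLin B x) := by
    simp [Matrix.toLpLin_apply, Matrix.mulVec_mulVec]
  rw [this]
  exact (hA _).trans (hB x)

theorem specNorm_le_one_of_conjTranspose_mul_self {A : Matrix (Fin n₁) (Fin n₂) 𝕜}
    (hA : Aᴴ * A = 1) : specNorm A ≤ 1 := by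
  rw [specNorm_le_one_iff]
  intro x
  refine le_of_sq_le_sq (le_of_eq ?_) (norm_nonneg _)
  rw [← inner_self_eq_norm_sq (𝕜 := 𝕜), ← inner_self_eq_norm_sq (𝕜 := 𝕜),
    ← LinearMap.adjoint_inner_right, ← Matrix.toEuclideanLin_conjTranspose_eq_adjoint]
  simp [Matrix.toLpLin_apply, Matrix.mulVec_mulVec, hA]

theorem specNorm_midpoint_le_one {A B : Matrix (Fin n₁) (Fin n₂) 𝕜}
    (hA : specNorm A ≤ 1) (hB : specNorm B ≤ 1) : specNorm ((1 / 2 : ℝ) • (A + B)) ≤ 1 := by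
  rw [specNorm_le_one_iff] at *
  intro x
  have : Matrix.toEuclideanLin ((1 / 2 : ℝ) • (A + B)) x =
      (1 / 2 : ℝ) • (Matrix.toEuclideanLin A x + Matrix.toEuclideanLin B x) := by
    ext i
    simp [Matrix.toLpLin_apply, Matrix.smul_mulVec]
  rw [this, norm_smul, Real.norm_of_nonneg (by norm_num)]
  linarith [norm_add_le (Matrix.toEuclideanLin A x) (Matrix.toEuclideanLin B x), hA x, hB x]

theorem norm_entry_le_one {W : Matrix (Fin n₁) (Fin n₂) 𝕜} (hW : specNorm W ≤ 1)
    (i : Fin n₁) (j : Fin n₂) : ‖W i j‖ ≤ 1 := by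
  have h := (specNorm_le_one_iff W).1 hW (EuclideanSpace.single j 1)
  have h2 := PiLp.norm_apply_le (Matrix.toEuclideanLin W (EuclideanSpace.single j 1)) i
  simpa [Matrix.toLpLin_apply] using h2.trans h

/-! ### The nuclear norm -/

theorem finrank_range_toEuclideanLin (X : Matrix (Fin n₁) (Fin n₂) 𝕜) :
    Module.finrank 𝕜 (Matrix.toEuclideanLin X).range = X.rank := by
  rw [Matrix.toEuclideanLin, Matrix.toLpLin_eq_toLin, ← Matrix.rank_eq_finrank_range_toLin]

theorem singVals_pos_iff (X : Matrix (Fin n₁) (Fin n₂) 𝕜) (i : Fin (min n₁ n₂)) :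
    0 < singVals X i ↔ (i : ℕ) < X.rank := by
  rw [singVals, LinearMap.singularValues_pos_iff_lt_finrank_range, finrank_range_toEuclideanLin]

theorem singVals_nonneg (X : Matrix (Fin n₁) (Fin n₂) 𝕜) (i : Fin (min n₁ n₂)) :
    0 ≤ singVals X i :=
  LinearMap.singularValues_nonneg _ _

/-- Singular values beyond the rank vanish, so the range `min n₁ n₂` can be enlarged to the
dimension of the domain, which matches a basis of right singular vectors. -/
theorem nucNorm_eq_sum (X : Matrix (Fin n₁) (Fin n₂) 𝕜) :
    nucNorm X = ∑ i : Fin n₂, (Matrix.toEuclideanLin X).singularValues i := by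
  simp only [nucNorm, singVals]
  rw [← Finset.sum_range fun i => (Matrix.toEuclideanLin X).singularValues i,
    ← Finset.sum_range fun i => (Matrix.toEuclideanLin X).singularValues i]
  refine Finset.sum_subset (by simp) fun i hi hi' => ?_
  rw [LinearMap.singularValues_eq_zero_iff_le_finrank_range, finrank_range_toEuclideanLin]
  have := X.rank_le_height
  simp only [Finset.mem_range] at hi hi'
  omega

/-- An orthonormal eigenbasis of `XᴴX`, whose eigenvalues are the squared singular values. -/
theorem exists_right_singular_basis (X : Matrix (Fin n₁) (Fin n₂) 𝕜) :
    ∃ b : OrthonormalBasis (Fin n₂) 𝕜 (EuclideanSpace 𝕜 (Fin n₂)),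
      ∀ i j, inner 𝕜 (Matrix.toEuclideanLin X (b i)) (Matrix.toEuclideanLin X (b j)) =
        if i = j then (((Matrix.toEuclideanLin X).singularValues i ^ 2 : ℝ) : 𝕜) else 0 := by
  set T := Matrix.toEuclideanLin X
  have hn : Module.finrank 𝕜 (EuclideanSpace 𝕜 (Fin n₂)) = n₂ := by simp
  refine ⟨T.isSymmetric_adjoint_comp_self.eigenvectorBasis hn, fun i j => ?_⟩
  set b := T.isSymmetric_adjoint_comp_self.eigenvectorBasis hn
  rw [← LinearMap.adjoint_inner_right, ← LinearMap.comp_apply,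
    LinearMap.IsSymmetric.apply_eigenvectorBasis, inner_smul_right,
    orthonormal_iff_ite.1 b.orthonormal, ← T.sq_singularValues_fin hn]
  split_ifs with h
  · simp [h]
  · simp

theorem trInner_le_nucNorm {W : Matrix (Fin n₁) (Fin n₂) 𝕜} (hW : specNorm W ≤ 1)
    (X : Matrix (Fin n₁) (Fin n₂) 𝕜) : trInner W X ≤ nucNorm X := by
  obtain ⟨b, hb⟩ := exists_right_singular_basis X
  rw [trInner_eq_sum_inner W X b, nucNorm_eq_sum]
  refine Finset.sum_le_sum fun i _ => ?_
  have h1 : ‖Matrix.toEuclideanLin X (b i)‖ = (Matrix.toEuclideanLin X).singularValues i := by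
    rw [← sq_eq_sq₀ (norm_nonneg _) (LinearMap.singularValues_nonneg _ _),
      ← inner_self_eq_norm_sq (𝕜 := 𝕜), hb, if_pos rfl, RCLike.ofReal_re]
  have h2 : ‖Matrix.toEuclideanLin W (b i)‖ ≤ 1 := by
    simpa using (specNorm_le_one_iff W).1 hW (b i)
  refine (RCLike.re_le_norm _).trans ((norm_inner_le_norm _ _).trans ?_)
  rw [h1]
  exact mul_le_of_le_one_left (LinearMap.singularValues_nonneg _ _) h2

/-- The maximizer is the partial isometry of the polar decomposition. With `trInner_le_nucNorm` this
makes the nuclear norm a maximum of linear forms, and its norm properties follow from that. -/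
theorem exists_trInner_eq_nucNorm (X : Matrix (Fin n₁) (Fin n₂) 𝕜) :
    ∃ W : Matrix (Fin n₁) (Fin n₂) 𝕜, specNorm W ≤ 1 ∧ trInner W X = nucNorm X := by
  obtain ⟨b, hb⟩ := exists_right_singular_basis X
  set T := Matrix.toEuclideanLin X with hT
  set s : Fin n₂ → ℝ := fun i => T.singularValues i with hs
  -- Normalize the images of the singular vectors; as `0⁻¹ = 0`, the kernel is sent to zero and `(s
  -- i)⁻¹ * s i` is always `0` or `1`.
  let L : EuclideanSpace 𝕜 (Fin n₂) →ₗ[𝕜] EuclideanSpace 𝕜 (Fin n₁) :=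
    b.toBasis.constr 𝕜 fun i => (((s i)⁻¹ : ℝ) : 𝕜) • T (b i)
  have hL : ∀ i, L (b i) = (((s i)⁻¹ : ℝ) : 𝕜) • T (b i) := fun i => by
    have h := b.toBasis.constr_basis 𝕜 (fun i => (((s i)⁻¹ : ℝ) : 𝕜) • T (b i)) i
    rwa [b.coe_toBasis] at h
  have hLL : ∀ i j, inner 𝕜 (L (b i)) (L (b j)) =
      if i = j then ((((s i)⁻¹ * s i) ^ 2 : ℝ) : 𝕜) else 0 := fun i j => by
    rw [hL, hL, inner_smul_left, inner_smul_right, hb]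
    split_ifs with h
    · subst h
      simp only [hs, RCLike.conj_ofReal]
      push_cast
      ring
    · simp
  refine ⟨Matrix.toEuclideanLin.symm L, ?_, ?_⟩
  · rw [specNorm_le_one_iff]
    intro x
    rw [LinearEquiv.apply_symm_apply]
    refine le_of_sq_le_sq ?_ (norm_nonneg _)
    have hx : L x = ∑ i, inner 𝕜 (b i) x • L (b i) := by
      conv_lhs => rw [← b.sum_repr' x]
      simp
    have h1 : ‖L x‖ ^ 2 = ∑ i, ‖inner 𝕜 (b i) x‖ ^ 2 * ((s i)⁻¹ * s i) ^ 2 := by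
      rw [← inner_self_eq_norm_sq (𝕜 := 𝕜), hx, sum_inner, map_sum]
      refine Finset.sum_congr rfl fun i _ => ?_
      rw [inner_sum, Finset.sum_eq_single i]
      · rw [inner_smul_left, inner_smul_right, hLL, if_pos rfl, ← mul_assoc, RCLike.conj_mul,
          ← RCLike.ofReal_pow, ← RCLike.ofReal_mul, RCLike.ofReal_re]
      · intro j _ hj
        rw [inner_smul_left, inner_smul_right, hLL, if_neg (Ne.symm hj)]
        simp
      · simp
    rw [h1, ← b.sum_sq_norm_inner_right x]
    refine Finset.sum_le_sum fun i _ => mul_le_of_le_one_right (by positivity) ?_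
    by_cases h : s i = 0
    · simp [h]
    · simp [inv_mul_cancel₀ h]
  · rw [trInner_eq_sum_inner _ X b, nucNorm_eq_sum]
    refine Finset.sum_congr rfl fun i _ => ?_
    rw [LinearEquiv.apply_symm_apply, hL, inner_smul_left, hb, if_pos rfl, RCLike.conj_ofReal,
      ← RCLike.ofReal_mul, RCLike.ofReal_re]
    change (s i)⁻¹ * s i ^ 2 = s i
    by_cases h : s i = 0
    · simp [h]
    · field_simp

theorem nucNorm_add_le (X Y : Matrix (Fin n₁) (Fin n₂) 𝕜) :
    nucNorm (X + Y) ≤ nucNorm X + nucNorm Y := by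
  obtain ⟨W, hW, h⟩ := exists_trInner_eq_nucNorm (X + Y)
  rw [← h, trInner_add_right]
  exact add_le_add (trInner_le_nucNorm hW X) (trInner_le_nucNorm hW Y)

theorem nucNorm_smul {c : ℝ} (hc : 0 < c) (X : Matrix (Fin n₁) (Fin n₂) 𝕜) :
    nucNorm (c • X) = c * nucNorm X := by
  refine le_antisymm ?_ ?_
  · obtain ⟨W, hW, h⟩ := exists_trInner_eq_nucNorm (c • X)
    rw [← h, trInner_smul_right]
    exact mul_le_mul_of_nonneg_left (trInner_le_nucNorm hW X) hc.le
  · obtain ⟨W, hW, h⟩ := exists_trInner_eq_nucNorm X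
    rw [← h, ← trInner_smul_right]
    exact trInner_le_nucNorm hW _

theorem trInner_vecMulVec (W : Matrix (Fin n₁) (Fin n₂) 𝕜) (u : EuclideanSpace 𝕜 (Fin n₁))
    (v : EuclideanSpace 𝕜 (Fin n₂)) :
    trInner W (Matrix.vecMulVec u.ofLp (star v.ofLp)) =
      RCLike.re (inner 𝕜 (Matrix.toEuclideanLin W v) u) := by
  rw [trInner_eq_sum]
  simp only [← map_sum]
  congr 1
  simp only [PiLp.inner_apply, RCLike.inner_apply, Matrix.toLpLin_apply, Matrix.mulVec, dotProduct,
    Matrix.vecMulVec_apply, Pi.star_apply, map_sum, Finset.mul_sum, map_mul, RCLike.star_def]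
  exact Finset.sum_congr rfl fun i _ => Finset.sum_congr rfl fun j _ => by ring

theorem nucNorm_vecMulVec_le (u : EuclideanSpace 𝕜 (Fin n₁)) (v : EuclideanSpace 𝕜 (Fin n₂)) :
    nucNorm (Matrix.vecMulVec u.ofLp (star v.ofLp)) ≤ ‖u‖ * ‖v‖ := by
  obtain ⟨W, hW, h⟩ := exists_trInner_eq_nucNorm (Matrix.vecMulVec u.ofLp (star v.ofLp))
  rw [← h, trInner_vecMulVec, mul_comm]
  refine (RCLike.re_le_norm _).trans ((norm_inner_le_norm _ _).trans ?_)
  exact mul_le_mul_of_nonneg_right ((specNorm_le_one_iff W).1 hW v) (norm_nonneg _)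

/-- Testing against the rank-one matrix `(Wx)xᴴ` gives `‖Wx‖² ≤ ‖Wx‖ ‖x‖`. This dual form of being a
contraction passes to limits and comes directly out of Hahn–Banach. -/
theorem specNorm_le_one_of_trInner_le_nucNorm {W : Matrix (Fin n₁) (Fin n₂) 𝕜}
    (h : ∀ X, trInner W X ≤ nucNorm X) : specNorm W ≤ 1 := by
  rw [specNorm_le_one_iff]
  intro x
  have h1 := (h _).trans (nucNorm_vecMulVec_le (Matrix.toEuclideanLin W x) x)
  rw [trInner_vecMulVec, inner_self_eq_norm_sq] at h1
  by_contra! h2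
  nlinarith [norm_nonneg x]

end

section

variable {𝕜 : Type*} [RCLike 𝕜] {n₁ n₂ : ℕ}

/-! ### Riesz representation of real linear forms, and extremal entries of contractions. -/

theorem trInner_single (W : Matrix (Fin n₁) (Fin n₂) 𝕜) (i : Fin n₁) (j : Fin n₂) (c : 𝕜) :
    trInner W (Matrix.single i j c) = RCLike.re (star (W i j) * c) := by
  rw [trInner_eq_sum, Finset.sum_eq_single i, Finset.sum_eq_single j]
  · simp
  · intro k _ hk
    simp [Matrix.single, hk.symm]
  · simp
  · intro k _ hk
    exact Finset.sum_eq_zero fun l _ => by simp [Matrix.single, hk.symm]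
  · simp

/-- Every real linear form on matrices is a trace inner product. -/
theorem exists_trInner_eq (w : Matrix (Fin n₁) (Fin n₂) 𝕜 →ₗ[ℝ] ℝ) :
    ∃ W : Matrix (Fin n₁) (Fin n₂) 𝕜, ∀ X, trInner W X = w X := by
  refine ⟨Matrix.of fun i j => ((w (Matrix.single i j 1) : ℝ) : 𝕜) +
    RCLike.I * ((w (Matrix.single i j RCLike.I) : ℝ) : 𝕜), fun X => ?_⟩
  have hX : X = ∑ i, ∑ j, Matrix.single i j (X i j) := Matrix.matrix_eq_sum_single X
  rw [← trInnerLin_apply, hX]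
  simp only [map_sum]
  refine Finset.sum_congr rfl fun i _ => Finset.sum_congr rfl fun j _ => ?_
  have h : Matrix.single i j (X i j) = RCLike.re (X i j) • Matrix.single i j (1 : 𝕜) +
      RCLike.im (X i j) • Matrix.single i j (RCLike.I : 𝕜) := by
    rw [Matrix.smul_single, Matrix.smul_single, ← Matrix.single_add]
    congr 1
    simp only [RCLike.real_smul_eq_coe_mul, mul_one]
    exact (RCLike.re_add_im _).symm
  rw [trInnerLin_apply, trInner_single, h, map_add, map_smul, map_smul]
  simp only [Matrix.of_apply, RCLike.star_def, map_add, map_mul, RCLike.conj_ofReal, RCLike.conj_I,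
    RCLike.mul_re, RCLike.mul_im, RCLike.ofReal_re, RCLike.ofReal_im, map_neg, RCLike.I_re,
    smul_eq_mul]
  -- This identity covers both fields: for `𝕜 = ℝ` the unit `I` and all imaginary parts are zero.
  have := RCLike.I_im' (X i j)
  linear_combination (w (Matrix.single i j RCLike.I)) * this

theorem trInner_rectDiag (M : Matrix (Fin n₁) (Fin n₂) 𝕜) (x : Fin (min n₁ n₂) → ℝ) :
    trInner M (rectDiag 𝕜 x) = ∑ k, x k * RCLike.re
      (M (Fin.castLE (min_le_left _ _) k) (Fin.castLE (min_le_right _ _) k)) := by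
  have h : rectDiag 𝕜 x = ∑ k, x k • Matrix.single (Fin.castLE (min_le_left n₁ n₂) k)
      (Fin.castLE (min_le_right n₁ n₂) k) (1 : 𝕜) := by
    ext i j
    simp only [rectDiag, Matrix.of_apply, Matrix.sum_apply, Matrix.smul_apply, Matrix.single]
    split_ifs with hij
    · rw [Finset.sum_eq_single ⟨i, lt_min i.isLt (hij ▸ j.isLt)⟩]
      · simp [Fin.ext_iff, hij, RCLike.real_smul_eq_coe_mul]
      · intro k _ hk
        rw [if_neg, smul_zero]
        rintro ⟨h1, -⟩
        exact hk (Fin.ext (by simpa using congrArg Fin.val h1))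
      · simp
    · symm
      refine Finset.sum_eq_zero fun k _ => ?_
      rw [if_neg, smul_zero]
      rintro ⟨h1, h2⟩
      exact hij (by rw [← h1, ← h2]; rfl)
  rw [h, ← trInnerLin_apply, map_sum]
  refine Finset.sum_congr rfl fun k _ => ?_
  rw [map_smul, trInnerLin_apply, trInner_single]
  simp

/-- A column of a contraction has norm at most one, and an entry with real part one uses all of it.
-/
theorem contraction_apply_of_re_eq_one {M : Matrix (Fin n₁) (Fin n₂) 𝕜} (hM : specNorm M ≤ 1)
    {i : Fin n₁} {j : Fin n₂} (h : RCLike.re (M i j) = 1) (k : Fin n₁) :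
    M k j = if k = i then 1 else 0 := by
  have h1 : ∑ l, ‖M l j‖ ^ 2 ≤ 1 := by
    have h2 := (specNorm_le_one_iff M).1 hM (EuclideanSpace.single j 1)
    have h3 := EuclideanSpace.norm_sq_eq (Matrix.toEuclideanLin M (EuclideanSpace.single j 1))
    have h4 : ‖EuclideanSpace.single j (1 : 𝕜)‖ = 1 := by simp
    rw [h4] at h2
    calc ∑ l, ‖M l j‖ ^ 2
        = ‖Matrix.toEuclideanLin M (EuclideanSpace.single j 1)‖ ^ 2 := by
          rw [h3]
          simp [Matrix.toLpLin_apply]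
      _ ≤ 1 := pow_le_one₀ (norm_nonneg _) h2
  have h4 := RCLike.norm_sq_eq_def (z := M i j)
  rw [← Finset.add_sum_erase _ _ (Finset.mem_univ i)] at h1
  split_ifs with hk
  · subst hk
    have h5 : 0 ≤ ∑ l ∈ Finset.univ.erase k, ‖M l j‖ ^ 2 := by positivity
    apply RCLike.ext
    · simpa using h
    · rw [RCLike.one_im]
      nlinarith
  · have h5 := Finset.single_le_sum (f := fun l => ‖M l j‖ ^ 2) (fun _ _ => by positivity)
      (Finset.mem_erase.2 ⟨hk, Finset.mem_univ k⟩)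
    change ‖M k j‖ ^ 2 ≤ _ at h5
    have : ‖M k j‖ = 0 := by nlinarith [norm_nonneg (M k j)]
    simpa using this

/-! ### Blocks of columns -/

theorem firstCols_add_lastCols {n r : ℕ} (h : r ≤ n) (U : Matrix (Fin n) (Fin n) 𝕜) :
    firstCols h U * (firstCols h U)ᴴ + lastCols r U * (lastCols r U)ᴴ = U * Uᴴ := by
  ext i j
  simp only [Matrix.add_apply, Matrix.mul_apply, Matrix.conjTranspose_apply]
  rw [← (finSumFinEquiv.trans (finCongr (Nat.add_sub_cancel' h))).sum_comp, Fintype.sum_sum_type]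
  rfl

theorem firstCols_conjTranspose_mul_self {n r : ℕ} (h : r ≤ n) {U : Matrix (Fin n) (Fin n) 𝕜}
    (hU : U ∈ Matrix.unitaryGroup (Fin n) 𝕜) : (firstCols h U)ᴴ * firstCols h U = 1 := by
  have h1 : Uᴴ * U = 1 := Matrix.mem_unitaryGroup_iff'.mp hU
  ext i j
  have hij := congrFun (congrFun h1 (Fin.castLE h i)) (Fin.castLE h j)
  simpa [firstCols, Matrix.mul_apply, Matrix.one_apply] using hij

theorem firstCols_conjTranspose_mul_lastCols {n r : ℕ} (h : r ≤ n) {U : Matrix (Fin n) (Fin n) 𝕜}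
    (hU : U ∈ Matrix.unitaryGroup (Fin n) 𝕜) : (firstCols h U)ᴴ * lastCols r U = 0 := by
  have h1 : Uᴴ * U = 1 := Matrix.mem_unitaryGroup_iff'.mp hU
  ext i j
  have hij := congrFun (congrFun h1 (Fin.castLE h i)) ⟨r + j, by omega⟩
  rw [Matrix.one_apply_ne (by simp only [ne_eq, Fin.ext_iff, Fin.val_castLE]; omega)] at hij
  simpa [firstCols, lastCols, Matrix.mul_apply] using hij

theorem specNorm_unitary {n : ℕ} {U : Matrix (Fin n) (Fin n) 𝕜}
    (hU : U ∈ Matrix.unitaryGroup (Fin n) 𝕜) : specNorm U ≤ 1 :=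
  specNorm_le_one_of_conjTranspose_mul_self (Matrix.mem_unitaryGroup_iff'.mp hU)

theorem specNorm_lastCols {n : ℕ} (r : ℕ) {U : Matrix (Fin n) (Fin n) 𝕜}
    (hU : U ∈ Matrix.unitaryGroup (Fin n) 𝕜) : specNorm (lastCols r U) ≤ 1 :=
  specNorm_le_one_of_conjTranspose_mul_self (lastCols_conjTranspose_mul_self r hU)

/-! ### Subgradients of the nuclear norm -/

/-- In singular coordinates `M = UᴴWV`, equality reads `∑ σ_k Re M_kk = ∑ σ_k` with every `Re M_kk ≤
1`. Hence `Re M_kk = 1` wherever `σ_k > 0`, and the corresponding columns and rows of `M` are unit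
vectors. -/
theorem subgradient_mul_firstCols {X W : Matrix (Fin n₁) (Fin n₂) 𝕜}
    {U : Matrix (Fin n₁) (Fin n₁) 𝕜} {V : Matrix (Fin n₂) (Fin n₂) 𝕜} (hX : IsSVD X U V)
    (hW : specNorm W ≤ 1) (hWX : trInner W X = nucNorm X) :
    W * firstCols X.rank_le_width V = firstCols X.rank_le_height U ∧
      (firstCols X.rank_le_height U)ᴴ * W = (firstCols X.rank_le_width V)ᴴ := by
  obtain ⟨hU, hV, hX⟩ := hX
  have hU1 : U * Uᴴ = 1 := Matrix.mem_unitaryGroup_iff.mp hU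
  have hV1 : V * Vᴴ = 1 := Matrix.mem_unitaryGroup_iff.mp hV
  set M := Uᴴ * W * V with hM
  have hMs : specNorm M ≤ 1 := specNorm_mul_le_one
    (specNorm_mul_le_one (specNorm_conjTranspose_le_one (specNorm_unitary hU)) hW)
    (specNorm_unitary hV)
  have hWV : W * V = U * M := by
    rw [hM, Matrix.mul_assoc, ← Matrix.mul_assoc U, hU1, Matrix.one_mul]
  have hUW : Uᴴ * W = M * Vᴴ := by
    rw [hM, Matrix.mul_assoc, Matrix.mul_assoc, hV1, Matrix.mul_one]
  have hsum : ∑ k, singVals X k * RCLike.re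
      (M (Fin.castLE (min_le_left _ _) k) (Fin.castLE (min_le_right _ _) k)) =
      ∑ k, singVals X k := by
    rw [← trInner_rectDiag]
    change _ = nucNorm X
    rw [← hWX]
    conv_rhs => rw [hX]
    rw [trInner, trInner, hM, ← Matrix.mul_assoc, Matrix.trace_mul_comm _ Vᴴ]
    simp only [Matrix.conjTranspose_mul, Matrix.conjTranspose_conjTranspose, Matrix.mul_assoc]
  have hre : ∀ i (h1 : i < n₁) (h2 : i < n₂), i < X.rank →
      RCLike.re (M ⟨i, h1⟩ ⟨i, h2⟩) = 1 := by
    intro i h1 h2 hi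
    have hle : ∀ k ∈ Finset.univ, singVals X k * RCLike.re
        (M (Fin.castLE (min_le_left _ _) k) (Fin.castLE (min_le_right _ _) k)) ≤ singVals X k :=
      fun k _ => mul_le_of_le_one_right (singVals_nonneg X k)
        ((RCLike.re_le_norm _).trans (norm_entry_le_one hMs _ _))
    have h3 := (Finset.sum_eq_sum_iff_of_le hle).1 hsum ⟨i, lt_min h1 h2⟩ (Finset.mem_univ _)
    have h4 := (singVals_pos_iff X ⟨i, lt_min h1 h2⟩).2 hi
    exact (mul_eq_left₀ h4.ne').1 h3
  have hr1 := X.rank_le_height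
  have hr2 := X.rank_le_width
  constructor
  · ext k i
    have h1 := congrFun (congrFun hWV k) (Fin.castLE hr2 i)
    have h2 := contraction_apply_of_re_eq_one hMs (hre i (by omega) (by omega) i.isLt)
    have h3 : (W * firstCols X.rank_le_width V) k i = (W * V) k (Fin.castLE hr2 i) := rfl
    rw [h3, h1, Matrix.mul_apply, Finset.sum_eq_single (Fin.castLE hr1 i)]
    · rw [show M (Fin.castLE hr1 i) (Fin.castLE hr2 i) = 1 from (h2 _).trans (if_pos rfl), mul_one]
      rfl
    · intro l _ hl
      rw [show M l (Fin.castLE hr2 i) = 0 from (h2 _).trans (if_neg hl), mul_zero]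
    · simp
  · ext i k
    have h1 := congrFun (congrFun hUW (Fin.castLE hr1 i)) k
    have h2 := contraction_apply_of_re_eq_one (specNorm_conjTranspose_le_one hMs)
      (i := ⟨i, by omega⟩) (j := ⟨i, by omega⟩)
      (by simpa using hre i (by omega) (by omega) i.isLt)
    have h3 : ((firstCols X.rank_le_height U)ᴴ * W) i k = (Uᴴ * W) (Fin.castLE hr1 i) k := rfl
    rw [h3, h1, Matrix.mul_apply, Finset.sum_eq_single (Fin.castLE hr2 i)]
    · have h4 : star (M (Fin.castLE hr1 i) (Fin.castLE hr2 i)) = 1 := (h2 _).trans (if_pos rfl)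
      have h5 : M (Fin.castLE hr1 i) (Fin.castLE hr2 i) = 1 := by
        rw [← star_star (M _ _), h4, star_one]
      rw [h5, one_mul]
      rfl
    · intro l _ hl
      have h4 : star (M (Fin.castLE hr1 i) l) = 0 := (h2 l).trans (if_neg hl)
      rw [star_eq_zero.1 h4, zero_mul]
    · simp

/-- A subgradient of the nuclear norm at `X` is `U₁ V₁ᴴ + U₂ Γ V₂ᴴ` for a contraction `Γ`. -/
theorem subgradient_eq_leadingPart_add {X W : Matrix (Fin n₁) (Fin n₂) 𝕜}
    {U : Matrix (Fin n₁) (Fin n₁) 𝕜} {V : Matrix (Fin n₂) (Fin n₂) 𝕜} (hX : IsSVD X U V)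
    (hW : specNorm W ≤ 1) (hWX : trInner W X = nucNorm X) :
    W = leadingPart X U V + lastCols X.rank U *
      ((lastCols X.rank U)ᴴ * W * lastCols X.rank V) * (lastCols X.rank V)ᴴ := by
  obtain ⟨h1, h2⟩ := subgradient_mul_firstCols hX hW hWX
  have hU1 : U * Uᴴ = 1 := Matrix.mem_unitaryGroup_iff.mp hX.1
  have hV1 : V * Vᴴ = 1 := Matrix.mem_unitaryGroup_iff.mp hX.2.1
  have hVV := firstCols_conjTranspose_mul_lastCols X.rank_le_width hX.2.1
  rw [← firstCols_add_lastCols X.rank_le_height] at hU1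
  rw [← firstCols_add_lastCols X.rank_le_width] at hV1
  rw [leadingPart]
  set U₁ := firstCols X.rank_le_height U
  set V₁ := firstCols X.rank_le_width V
  set U₂ := lastCols X.rank U
  set V₂ := lastCols X.rank V
  calc W = W * (V₁ * V₁ᴴ + V₂ * V₂ᴴ) := by rw [hV1, Matrix.mul_one]
    _ = W * V₁ * V₁ᴴ + (U₁ * U₁ᴴ + U₂ * U₂ᴴ) * (W * (V₂ * V₂ᴴ)) := by
      rw [hU1, Matrix.one_mul, Matrix.mul_add, Matrix.mul_assoc]
    _ = W * V₁ * V₁ᴴ + (U₁ * (U₁ᴴ * W * V₂) * V₂ᴴ + U₂ * (U₂ᴴ * W * V₂) * V₂ᴴ) := by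
      simp only [Matrix.add_mul, Matrix.mul_assoc]
    _ = _ := by rw [h1, h2, hVV, Matrix.mul_zero, Matrix.zero_mul, zero_add]

theorem trInner_leadingPart {X : Matrix (Fin n₁) (Fin n₂) 𝕜}
    {U : Matrix (Fin n₁) (Fin n₁) 𝕜} {V : Matrix (Fin n₂) (Fin n₂) 𝕜} (hX : IsSVD X U V) :
    trInner (leadingPart X U V) X = nucNorm X := by
  have hU1 : Uᴴ * U = 1 := Matrix.mem_unitaryGroup_iff'.mp hX.1
  have hV1 : Vᴴ * V = 1 := Matrix.mem_unitaryGroup_iff'.mp hX.2.1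
  have hr1 := X.rank_le_height
  have hr2 := X.rank_le_width
  have h1 : (firstCols hr1 U)ᴴ * X * firstCols hr2 V =
      (rectDiag 𝕜 (singVals X)).submatrix (Fin.castLE hr1) (Fin.castLE hr2) := by
    have h2 : Uᴴ * X * V = rectDiag 𝕜 (singVals X) := by
      rw [hX.2.2]
      simp only [← Matrix.mul_assoc, hU1, Matrix.one_mul]
      rw [Matrix.mul_assoc, hV1, Matrix.mul_one, ← hX.2.2]
    rw [← h2]
    rfl
  rw [trInner, leadingPart, Matrix.conjTranspose_mul, Matrix.conjTranspose_conjTranspose,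
    Matrix.mul_assoc, Matrix.trace_mul_comm, h1]
  simp only [Matrix.trace, Matrix.diag, map_sum, nucNorm, Matrix.submatrix_apply, rectDiag,
    Matrix.of_apply, Fin.val_castLE, dite_true, RCLike.ofReal_re, singVals]
  rw [← Finset.sum_range fun i => (Matrix.toEuclideanLin X).singularValues i,
    ← Finset.sum_range fun i => (Matrix.toEuclideanLin X).singularValues i]
  refine Finset.sum_subset (by simp; omega) fun i _ hi => ?_
  rw [LinearMap.singularValues_eq_zero_iff_le_finrank_range, finrank_range_toEuclideanLin]
  simpa using hi

theorem specNorm_leadingPart {X : Matrix (Fin n₁) (Fin n₂) 𝕜}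
    {U : Matrix (Fin n₁) (Fin n₁) 𝕜} {V : Matrix (Fin n₂) (Fin n₂) 𝕜} (hX : IsSVD X U V) :
    specNorm (leadingPart X U V) ≤ 1 :=
  specNorm_mul_le_one
    (specNorm_le_one_of_conjTranspose_mul_self (firstCols_conjTranspose_mul_self _ hX.1))
    (specNorm_conjTranspose_le_one
      (specNorm_le_one_of_conjTranspose_mul_self (firstCols_conjTranspose_mul_self _ hX.2.1)))

/-- For Hermitian `X` the adjoint of `U₁V₁ᴴ` is again a contraction attaining the nuclear norm at
`X`, so `subgradient_mul_firstCols` gives `V₁U₁ᴴV₁ = U₁`. No relation between `U` and `V` is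
assumed. -/
theorem leadingPart_isHermitian {n : ℕ} {X U V : Matrix (Fin n) (Fin n) 𝕜} (hX : IsSVD X U V)
    (hsymm : Xᴴ = X) : (leadingPart X U V)ᴴ = leadingPart X U V := by
  have h1 : trInner (leadingPart X U V)ᴴ X = nucNorm X := by
    rw [← trInner_leadingPart hX, ← trInner_conjTranspose (leadingPart X U V), hsymm]
  obtain ⟨h2, -⟩ := subgradient_mul_firstCols hX
    (specNorm_conjTranspose_le_one (specNorm_leadingPart hX)) h1
  have hV := firstCols_conjTranspose_mul_self X.rank_le_width hX.2.1
  rw [leadingPart] at h2 ⊢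
  set U₁ := firstCols X.rank_le_height U
  set V₁ := firstCols X.rank_le_width V
  rw [Matrix.conjTranspose_mul, Matrix.conjTranspose_conjTranspose] at h2 ⊢
  have h3 : U₁ᴴ * V₁ = V₁ᴴ * U₁ := by
    nth_rw 2 [← h2]
    rw [← Matrix.mul_assoc, ← Matrix.mul_assoc, hV, Matrix.one_mul]
  calc V₁ * U₁ᴴ = V₁ * (V₁ * U₁ᴴ * V₁)ᴴ := by rw [h2]
    _ = V₁ * (V₁ᴴ * U₁) * V₁ᴴ := by
      simp only [Matrix.conjTranspose_mul, Matrix.conjTranspose_conjTranspose, Matrix.mul_assoc]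
    _ = U₁ * V₁ᴴ := by rw [← h3, ← Matrix.mul_assoc, h2]

theorem leadingPart_mem (S : MatrixSpace n₁ n₂) {X : Matrix (Fin n₁) (Fin n₂) 𝕜}
    (hXS : X ∈ S.toSubmodule 𝕜) {U : Matrix (Fin n₁) (Fin n₁) 𝕜} {V : Matrix (Fin n₂) (Fin n₂) 𝕜}
    (hX : IsSVD X U V) : leadingPart X U V ∈ S.toSubmodule 𝕜 := by
  cases S with
  | full => exact Submodule.mem_top
  | selfAdj => exact leadingPart_isHermitian hX hXS

/-- A contraction may be replaced by one in `𝕍` that has the same inner products with `𝕍`. -/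
theorem exists_mem_contraction (S : MatrixSpace n₁ n₂) {W : Matrix (Fin n₁) (Fin n₂) 𝕜}
    (hW : specNorm W ≤ 1) : ∃ W' ∈ S.toSubmodule 𝕜, specNorm W' ≤ 1 ∧
      ∀ X ∈ S.toSubmodule 𝕜, trInner W' X = trInner W X := by
  cases S with
  | full => exact ⟨W, Submodule.mem_top, hW, fun _ _ => rfl⟩
  | selfAdj =>
    -- The self-adjoint part: `W` and `Wᴴ` pair equally with self-adjoint matrices.
    refine ⟨(1 / 2 : ℝ) • (W + Wᴴ), ?_,
      specNorm_midpoint_le_one hW (specNorm_conjTranspose_le_one hW), fun X hX => ?_⟩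
    · change ((1 / 2 : ℝ) • (W + Wᴴ))ᴴ = (1 / 2 : ℝ) • (W + Wᴴ)
      rw [Matrix.conjTranspose_smul, Matrix.conjTranspose_add, Matrix.conjTranspose_conjTranspose,
        star_trivial, add_comm]
    · have h : trInner Wᴴ X = trInner W X := by
        nth_rw 1 [← show Xᴴ = X from hX]
        exact trInner_conjTranspose W X
      rw [trInner_smul_left, trInner_add_left, h]
      ring

end

section

variable {𝕜 : Type*} [RCLike 𝕜] {n₁ n₂ d : ℕ}

/-! ### First-order optimality conditions -/

/-- A linear form that supports the nuclear norm at `X` along a subspace extends to a subgradient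
at `X`. -/
theorem exists_subgradient (H : Submodule ℝ (Matrix (Fin n₁) (Fin n₂) 𝕜))
    (l : Matrix (Fin n₁) (Fin n₂) 𝕜 →ₗ[ℝ] ℝ) (X : Matrix (Fin n₁) (Fin n₂) 𝕜)
    (h : ∀ D ∈ H, nucNorm X + l D ≤ nucNorm (X + D)) :
    ∃ W : Matrix (Fin n₁) (Fin n₂) 𝕜, specNorm W ≤ 1 ∧ trInner W X = nucNorm X ∧
      ∀ D ∈ H, trInner W D = l D := by
  let g : (Matrix (Fin n₁) (Fin n₂) 𝕜 × ℝ) →ₗ.[ℝ] ℝ :=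
    ⟨H.prod ⊤, (l ∘ₗ LinearMap.fst ℝ _ ℝ).domRestrict (H.prod ⊤)⟩
  -- Hahn–Banach is applied on the product with `ℝ`. The infimum of `N (D, t)` over `t` is the
  -- directional derivative of the norm at `X`; keeping `t` as a variable leaves `N` visibly
  -- sublinear.
  let N : Matrix (Fin n₁) (Fin n₂) 𝕜 × ℝ → ℝ := fun z => nucNorm (z.1 + z.2 • X) - z.2 * nucNorm X
  have key : ∀ D ∈ H, ∀ t : ℝ, 0 < t → l D ≤ nucNorm (D + t • X) - t * nucNorm X := by
    intro D hD t ht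
    have h1 := h (t⁻¹ • D) (H.smul_mem _ hD)
    have h2 : D + t • X = t • (X + t⁻¹ • D) := by
      rw [smul_add, smul_smul, mul_inv_cancel₀ ht.ne', one_smul, add_comm]
    rw [h2, nucNorm_smul ht]
    have h3 : t * (nucNorm X + l (t⁻¹ • D)) = t * nucNorm X + l D := by
      rw [map_smul, smul_eq_mul]
      field_simp
    nlinarith [mul_le_mul_of_nonneg_left h1 ht.le]
  obtain ⟨w, hw1, hw2⟩ := exists_extension_of_le_sublinear g N
    (fun c hc z => by
      simp only [N, Prod.smul_fst, Prod.smul_snd, smul_eq_mul]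
      rw [mul_smul, ← smul_add, nucNorm_smul hc]
      ring)
    (fun z z' => by
      simp only [N, Prod.fst_add, Prod.snd_add]
      have h1 : z.1 + z'.1 + (z.2 + z'.2) • X = (z.1 + z.2 • X) + (z'.1 + z'.2 • X) := by
        rw [add_smul]
        abel
      rw [h1]
      linarith [nucNorm_add_le (z.1 + z.2 • X) (z'.1 + z'.2 • X)])
    (fun z => by
      obtain ⟨⟨D, t⟩, hD, -⟩ := z
      change l D ≤ nucNorm (D + t • X) - t * nucNorm X
      -- `key` needs `t > 0`. By the triangle inequality `N (D, t)` does not increase with `t`, so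
      -- the bound at `|t| + 1` suffices.
      have h1 : 0 < |t| + 1 := by positivity
      have h2 : 0 < |t| + 1 - t := by linarith [le_abs_self t]
      have h3 := key D hD (|t| + 1) h1
      have h4 : D + (|t| + 1) • X = (D + t • X) + (|t| + 1 - t) • X := by
        rw [add_assoc, ← add_smul]
        congr 2
        ring
      have h5 := nucNorm_add_le (D + t • X) ((|t| + 1 - t) • X)
      rw [nucNorm_smul h2, ← h4] at h5
      linarith)
  have hw3 : ∀ D ∈ H, ∀ t : ℝ, w (D, t) = l D := fun D hD t => hw1 ⟨(D, t), hD, trivial⟩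
  -- The extension vanishes on `(0, t)`, so `t` is free: `t = 0` makes `W` a contraction, and `D =
  -- -X`, `t = 1` gives `⟨W, X⟩ ≥ ‖X‖_*`.
  have hw4 : ∀ D t, w (D, 0) ≤ nucNorm (D + t • X) - t * nucNorm X := by
    intro D t
    have h1 : ((D, 0) : Matrix (Fin n₁) (Fin n₂) 𝕜 × ℝ) = (D, t) + (0, -t) := by simp
    rw [h1, map_add, hw3 0 H.zero_mem, map_zero, add_zero]
    exact hw2 (D, t)
  obtain ⟨W, hW⟩ := exists_trInner_eq (w ∘ₗ LinearMap.inl ℝ _ ℝ)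
  have hW1 : specNorm W ≤ 1 := specNorm_le_one_of_trInner_le_nucNorm fun D => by
    rw [hW]
    simpa using hw4 D 0
  refine ⟨W, hW1, le_antisymm (trInner_le_nucNorm hW1 X) ?_, fun D hD => ?_⟩
  · have h0 : nucNorm (0 : Matrix (Fin n₁) (Fin n₂) 𝕜) = 0 := by
      have := nucNorm_smul (c := 2) (by norm_num) (0 : Matrix (Fin n₁) (Fin n₂) 𝕜)
      rw [smul_zero] at this
      linarith
    have h1 := hw4 (-X) 1
    rw [one_smul, neg_add_cancel, h0] at h1
    have h2 : trInner W (-X) = w (-X, 0) := hW (-X)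
    rw [← h2, ← trInnerLin_apply, map_neg, trInnerLin_apply] at h1
    linarith
  · rw [hW]
    exact hw3 D hD 0

theorem nonneg_of_forall_add_sq_nonneg {a b : ℝ}
    (h : ∀ t : ℝ, 0 < t → t ≤ 1 → 0 ≤ t * a + t ^ 2 * b) : 0 ≤ a := by
  have h1 : Tendsto (fun t : ℝ => a + t * b) (𝓝[>] 0) (𝓝 (a + 0 * b)) :=
    (Continuous.tendsto (by fun_prop) 0).mono_left nhdsWithin_le_nhds
  rw [zero_mul, add_zero] at h1
  refine ge_of_tendsto h1 ?_
  filter_upwards [Ioc_mem_nhdsGT (zero_lt_one' ℝ)] with t ht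
  have h2 := h t ht.1 ht.2
  have h3 : t * a + t ^ 2 * b = t * (a + t * b) := by ring
  rw [h3] at h2
  exact nonneg_of_mul_nonneg_right h2 ht.1

/-- The negative gradient of the smooth part of the objective function, divided by `ρ`. -/
noncomputable def rcsGradient (Θ : Fin d → Matrix (Fin n₁) (Fin n₂) 𝕜) (m : ℕ)
    (idx : ℕ → Fin d) (y : ℕ → ℝ) (ρ γ : ℝ) (G Xtil X : Matrix (Fin n₁) (Fin n₂) 𝕜) :
    Matrix (Fin n₁) (Fin n₂) 𝕜 :=
  (1 / (m * ρ)) • ∑ i ∈ Finset.range m, (y i - trInner (Θ (idx i)) X) • Θ (idx i) +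
    (G - γ • (X - Xtil))

/-- The smooth part is quadratic, so its expansion in `t` is exact; the nuclear norm is bounded by
its chord from `X` to `X + D`. At a minimizer, dividing by `t` and letting `t → 0` leaves the
subgradient inequality. -/
theorem rcsObjective_add_smul_le (Θ : Fin d → Matrix (Fin n₁) (Fin n₂) 𝕜) (m : ℕ)
    (idx : ℕ → Fin d) (y : ℕ → ℝ) {ρ : ℝ} (hρ : 0 < ρ) (γ : ℝ)
    (G Xtil X D : Matrix (Fin n₁) (Fin n₂) 𝕜) {t : ℝ} (ht : 0 < t) (ht1 : t ≤ 1) :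
    rcsObjective Θ m idx y ρ γ G Xtil (X + t • D) ≤ rcsObjective Θ m idx y ρ γ G Xtil X +
      (t * (ρ * (nucNorm (X + D) - nucNorm X - trInner (rcsGradient Θ m idx y ρ γ G Xtil X) D)) +
        t ^ 2 * (1 / (2 * m) * ∑ i ∈ Finset.range m, trInner (Θ (idx i)) D ^ 2 +
          ρ * (γ / 2) * trInner D D)) := by
  have hnuc : nucNorm (X + t • D) ≤ nucNorm X + t * (nucNorm (X + D) - nucNorm X) := by
    rcases eq_or_lt_of_le ht1 with rfl | h1
    · simp
    have h2 : X + t • D = (1 - t) • X + t • (X + D) := by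
      rw [smul_add, sub_smul, one_smul]
      abel
    have h3 := nucNorm_add_le ((1 - t) • X) (t • (X + D))
    rw [← h2, nucNorm_smul (sub_pos.2 h1), nucNorm_smul ht] at h3
    linarith
  have hgrad : trInner (rcsGradient Θ m idx y ρ γ G Xtil X) D =
      1 / (m * ρ) * ∑ i ∈ Finset.range m,
        (y i - trInner (Θ (idx i)) X) * trInner (Θ (idx i)) D +
      (trInner G D - γ * trInner (X - Xtil) D) := by
    rw [rcsGradient, trInner_comm, ← trInnerLin_apply]
    simp only [map_add, map_sub, map_smul, map_sum, trInnerLin_apply, smul_eq_mul, trInner_comm D,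
      trInner_sub_left]
  have hsum : ∑ i ∈ Finset.range m, (y i - trInner (Θ (idx i)) (X + t • D)) ^ 2 =
      ∑ i ∈ Finset.range m, (y i - trInner (Θ (idx i)) X) ^ 2 -
        2 * t * ∑ i ∈ Finset.range m, (y i - trInner (Θ (idx i)) X) * trInner (Θ (idx i)) D +
        t ^ 2 * ∑ i ∈ Finset.range m, trInner (Θ (idx i)) D ^ 2 := by
    rw [Finset.mul_sum, Finset.mul_sum, ← Finset.sum_sub_distrib, ← Finset.sum_add_distrib]
    refine Finset.sum_congr rfl fun i _ => ?_
    rw [trInner_add_right, trInner_smul_right]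
    ring
  have hfrob : trInner (X + t • D - Xtil) (X + t • D - Xtil) = trInner (X - Xtil) (X - Xtil) +
      2 * t * trInner (X - Xtil) D + t ^ 2 * trInner D D := by
    rw [add_sub_right_comm, trInner_add_left, trInner_add_right, trInner_add_right,
      trInner_smul_left, trInner_smul_left, trInner_smul_right, trInner_smul_right,
      trInner_comm D (X - Xtil)]
    ring
  rw [rcsObjective, rcsObjective, frobNorm_sq, frobNorm_sq, hsum, hfrob, hgrad, trInner_add_right,
    trInner_smul_right]
  have hρ' : ρ * (1 / (m * ρ)) = 1 / m := by field_simp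
  have h2m : (1 : ℝ) / (2 * m) * 2 = 1 / m := by
    rw [one_div, mul_inv]
    ring
  set A := ∑ i ∈ Finset.range m, (y i - trInner (Θ (idx i)) X) * trInner (Θ (idx i)) D
  have h3 := mul_le_mul_of_nonneg_left hnuc hρ.le
  linear_combination h3 + t * A * hρ' - t * A * h2m

/-- An optimal solution of the rank-correction step has a subgradient of the nuclear norm that
agrees with the gradient of the smooth part on the feasible directions. -/
theorem exists_subgradient_of_isMinOn {S : Submodule ℝ (Matrix (Fin n₁) (Fin n₂) 𝕜)}
    {Θ : Fin d → Matrix (Fin n₁) (Fin n₂) 𝕜} {α : Finset (Fin d)}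
    {Xbar : Matrix (Fin n₁) (Fin n₂) 𝕜} {m : ℕ}
    {idx : ℕ → Fin d} {y : ℕ → ℝ} {ρ γ : ℝ} (hρ : 0 < ρ)
    {G Xtil X : Matrix (Fin n₁) (Fin n₂) 𝕜} (hX : X ∈ rcsFeasible S Θ α Xbar)
    (hmin : IsMinOn (rcsObjective Θ m idx y ρ γ G Xtil) (rcsFeasible S Θ α Xbar) X) :
    ∃ W : Matrix (Fin n₁) (Fin n₂) 𝕜, specNorm W ≤ 1 ∧ trInner W X = nucNorm X ∧
      ∀ D ∈ S, (∀ k ∈ α, trInner (Θ k) D = 0) →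
        trInner W D = trInner (rcsGradient Θ m idx y ρ γ G Xtil X) D := by
  let H : Submodule ℝ (Matrix (Fin n₁) (Fin n₂) 𝕜) :=
    S ⊓ ⨅ k ∈ α, LinearMap.ker (trInnerLin (Θ k))
  have hH : ∀ D, D ∈ H ↔ D ∈ S ∧ ∀ k ∈ α, trInner (Θ k) D = 0 := fun D => by
    simp [H, Submodule.mem_iInf]
  obtain ⟨W, h1, h2, h3⟩ := exists_subgradient H
    (trInnerLin (rcsGradient Θ m idx y ρ γ G Xtil X)) X fun D hD => by
      have hD' := (hH D).1 hD
      have h0 : 0 ≤ ρ * (nucNorm (X + D) - nucNorm X -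
          trInner (rcsGradient Θ m idx y ρ γ G Xtil X) D) := by
        refine nonneg_of_forall_add_sq_nonneg (b := 1 / (2 * m) *
          ∑ i ∈ Finset.range m, trInner (Θ (idx i)) D ^ 2 + ρ * (γ / 2) * trInner D D)
          fun t ht ht1 => ?_
        have h4 : X + t • D ∈ rcsFeasible S Θ α Xbar := by
          refine ⟨S.add_mem hX.1 (S.smul_mem t hD'.1), fun k hk => ?_⟩
          rw [trInner_add_right, trInner_smul_right, hD'.2 k hk, mul_zero, add_zero, hX.2 k hk]
        have h5 := isMinOn_iff.1 hmin _ h4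
        have h6 := rcsObjective_add_smul_le Θ m idx y hρ γ G Xtil X D ht ht1
        linarith
      have := nonneg_of_mul_nonneg_right h0 hρ
      rw [trInnerLin_apply]
      linarith
  exact ⟨W, h1, h2, fun D hD hDα => h3 D ((hH D).2 ⟨hD, hDα⟩)⟩

theorem IsOrthonormalBasisOf.mem {S : Submodule ℝ (Matrix (Fin n₁) (Fin n₂) 𝕜)}
    {Θ : Fin d → Matrix (Fin n₁) (Fin n₂) 𝕜} (hΘ : IsOrthonormalBasisOf S Θ) (k : Fin d) :
    Θ k ∈ S :=
  hΘ.span_eq ▸ Submodule.subset_span (Set.mem_range_self k)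

theorem IsOrthonormalBasisOf.sum_repr {S : Submodule ℝ (Matrix (Fin n₁) (Fin n₂) 𝕜)}
    {Θ : Fin d → Matrix (Fin n₁) (Fin n₂) 𝕜} (hΘ : IsOrthonormalBasisOf S Θ)
    {X : Matrix (Fin n₁) (Fin n₂) 𝕜} (hX : X ∈ S) : ∑ k, trInner (Θ k) X • Θ k = X := by
  rw [← hΘ.span_eq, Submodule.mem_span_range_iff_exists_fun] at hX
  obtain ⟨c, rfl⟩ := hX
  refine Finset.sum_congr rfl fun k _ => ?_
  congr 1
  rw [← trInnerLin_apply, map_sum]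
  simp [hΘ.orthonormal]

/-- The optimality condition in the coordinates of the orthonormal basis. -/
theorem exists_subgradient_coordinates {S : Submodule ℝ (Matrix (Fin n₁) (Fin n₂) 𝕜)}
    {Θ : Fin d → Matrix (Fin n₁) (Fin n₂) 𝕜} (hΘ : IsOrthonormalBasisOf S Θ) {α : Finset (Fin d)}
    {Xbar : Matrix (Fin n₁) (Fin n₂) 𝕜} {m : ℕ}
    {idx : ℕ → Fin d} {ξ : ℕ → ℝ} {ν ρ γ : ℝ} (hρ : 0 < ρ)
    {G Xtil X : Matrix (Fin n₁) (Fin n₂) 𝕜} (hX : X ∈ rcsFeasible S Θ α Xbar)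
    (hmin : IsMinOn (rcsObjective Θ m idx (fun i => trInner (Θ (idx i)) Xbar + ν * ξ i) ρ γ G Xtil)
      (rcsFeasible S Θ α Xbar) X) :
    ∃ W : Matrix (Fin n₁) (Fin n₂) 𝕜, specNorm W ≤ 1 ∧ trInner W X = nucNorm X ∧
      ∀ k ∈ αᶜ, ((∑ i ∈ Finset.range m, if idx i = k then (1 : ℝ) else 0) / m + ρ * γ) *
          (trInner (Θ k) (X - Xbar) / ρ) =
        ν * ((∑ i ∈ Finset.range m, if idx i = k then ξ i else 0) / (m * ρ)) -
          trInner W (Θ k) + trInner G (Θ k) - γ * trInner (Xbar - Xtil) (Θ k) := by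
  obtain ⟨W, h1, h2, h3⟩ := exists_subgradient_of_isMinOn hρ hX hmin
  refine ⟨W, h1, h2, fun k hk => ?_⟩
  have h4 := h3 (Θ k) (hΘ.mem k) fun l hl => by
    rw [hΘ.orthonormal, if_neg]
    rintro rfl
    exact Finset.mem_compl.1 hk hl
  have h5 : trInner (∑ i ∈ Finset.range m,
      (trInner (Θ (idx i)) Xbar + ν * ξ i - trInner (Θ (idx i)) X) • Θ (idx i)) (Θ k) =
      ν * (∑ i ∈ Finset.range m, if idx i = k then ξ i else 0) -
        (∑ i ∈ Finset.range m, if idx i = k then (1 : ℝ) else 0) * trInner (Θ k) (X - Xbar) := by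
    rw [trInner_comm, ← trInnerLin_apply, map_sum, Finset.mul_sum, Finset.sum_mul,
      ← Finset.sum_sub_distrib]
    refine Finset.sum_congr rfl fun i _ => ?_
    rw [map_smul, trInnerLin_apply, hΘ.orthonormal, trInner_sub_right, smul_eq_mul]
    by_cases h : idx i = k
    · subst h
      simp only [if_true]
      ring
    · simp [h, Ne.symm h]
  have h6 : trInner (X - Xtil) (Θ k) =
      trInner (Θ k) (X - Xbar) + trInner (Xbar - Xtil) (Θ k) := by
    rw [trInner_comm (Θ k), ← trInner_add_left, sub_add_sub_cancel]
  rw [rcsGradient, trInner_add_left, trInner_smul_left, h5, trInner_sub_left, trInner_smul_left,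
    h6] at h4
  rw [h4]
  field_simp
  ring

end

section

variable {𝕜 : Type*} [RCLike 𝕜] {n₁ n₂ d : ℕ}

/-! ### Perturbations that preserve the rank -/

theorem rectDiag_singVals_apply_eq_zero (X : Matrix (Fin n₁) (Fin n₂) 𝕜) {i : Fin n₁} {j : Fin n₂}
    (h : X.rank ≤ i ∨ X.rank ≤ j) : rectDiag 𝕜 (singVals X) i j = 0 := by
  simp only [rectDiag, Matrix.of_apply]
  split_ifs with hij
  · have h1 := (singVals_pos_iff X ⟨i, lt_min i.isLt (hij ▸ j.isLt)⟩).not.2 (by simp only; omega)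
    rw [le_antisymm (not_lt.1 h1) (singVals_nonneg X _), RCLike.ofReal_zero]
  · rfl

theorem lastCols_conjTranspose_mul {X : Matrix (Fin n₁) (Fin n₂) 𝕜}
    {U : Matrix (Fin n₁) (Fin n₁) 𝕜} {V : Matrix (Fin n₂) (Fin n₂) 𝕜} (hX : IsSVD X U V) :
    (lastCols X.rank U)ᴴ * X = 0 := by
  have hU1 : Uᴴ * U = 1 := Matrix.mem_unitaryGroup_iff'.mp hX.1
  have h1 : Uᴴ * X = rectDiag 𝕜 (singVals X) * Vᴴ := by
    conv_lhs => rw [hX.2.2]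
    rw [← Matrix.mul_assoc, ← Matrix.mul_assoc, hU1, Matrix.one_mul]
  ext i j
  refine (congrFun (congrFun h1 ⟨X.rank + i, by omega⟩) j).trans ?_
  rw [Matrix.mul_apply]
  exact Finset.sum_eq_zero fun l _ => by
    rw [rectDiag_singVals_apply_eq_zero X (Or.inl (by simp)), zero_mul]

theorem mul_lastCols {X : Matrix (Fin n₁) (Fin n₂) 𝕜}
    {U : Matrix (Fin n₁) (Fin n₁) 𝕜} {V : Matrix (Fin n₂) (Fin n₂) 𝕜} (hX : IsSVD X U V) :
    X * lastCols X.rank V = 0 := by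
  have hV1 : Vᴴ * V = 1 := Matrix.mem_unitaryGroup_iff'.mp hX.2.1
  have h1 : X * V = U * rectDiag 𝕜 (singVals X) := by
    conv_lhs => rw [hX.2.2]
    rw [Matrix.mul_assoc, hV1, Matrix.mul_one]
  ext i j
  refine (congrFun (congrFun h1 i) ⟨X.rank + j, by omega⟩).trans ?_
  rw [Matrix.mul_apply]
  exact Finset.sum_eq_zero fun l _ => by
    rw [rectDiag_singVals_apply_eq_zero X (Or.inr (by simp)), mul_zero]

theorem det_firstCols_ne_zero {X : Matrix (Fin n₁) (Fin n₂) 𝕜}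
    {U : Matrix (Fin n₁) (Fin n₁) 𝕜} {V : Matrix (Fin n₂) (Fin n₂) 𝕜} (hX : IsSVD X U V) :
    ((firstCols X.rank_le_height U)ᴴ * X * firstCols X.rank_le_width V).det ≠ 0 := by
  have hU1 : Uᴴ * U = 1 := Matrix.mem_unitaryGroup_iff'.mp hX.1
  have hV1 : Vᴴ * V = 1 := Matrix.mem_unitaryGroup_iff'.mp hX.2.1
  have hr1 := X.rank_le_height
  have hr2 := X.rank_le_width
  have h2 : Uᴴ * X * V = rectDiag 𝕜 (singVals X) := by
    conv_lhs => rw [hX.2.2]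
    rw [Matrix.mul_assoc, Matrix.mul_assoc, hV1, Matrix.mul_one, ← Matrix.mul_assoc, hU1,
      Matrix.one_mul]
  have h1 : (firstCols hr1 U)ᴴ * X * firstCols hr2 V =
      Matrix.diagonal fun i : Fin X.rank =>
        ((singVals X ⟨i, lt_min (i.isLt.trans_le hr1) (i.isLt.trans_le hr2)⟩ : ℝ) : 𝕜) := by
    ext i j
    refine (congrFun (congrFun h2 (Fin.castLE hr1 i)) (Fin.castLE hr2 j)).trans ?_
    simp only [rectDiag, Matrix.of_apply, Fin.val_castLE, Matrix.diagonal_apply, Fin.ext_iff]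
    rfl
  rw [h1, Matrix.det_diagonal, Finset.prod_ne_zero_iff]
  intro i _
  rw [RCLike.ofReal_ne_zero]
  exact ((singVals_pos_iff X ⟨i, _⟩).2 i.isLt).ne'

/-- Directions along which the rank of `X` is preserved to first order have no component in the
complementary block. -/
theorem block_eq_zero_of_rank_le {ι : Type*} {l : Filter ι} [l.NeBot]
    {X : Matrix (Fin n₁) (Fin n₂) 𝕜} {U : Matrix (Fin n₁) (Fin n₁) 𝕜}
    {V : Matrix (Fin n₂) (Fin n₂) 𝕜} (hX : IsSVD X U V) {ρ : ι → ℝ} (hρ : ∀ j, 0 < ρ j)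
    (hρ0 : Tendsto ρ l (𝓝 0)) {D : ι → Matrix (Fin n₁) (Fin n₂) 𝕜}
    {D' : Matrix (Fin n₁) (Fin n₂) 𝕜} (hD : Tendsto D l (𝓝 D'))
    (hrank : ∀ j, (X + ρ j • D j).rank ≤ X.rank) :
    (lastCols X.rank U)ᴴ * D' * lastCols X.rank V = 0 := by
  set U₁ := firstCols X.rank_le_height U
  set V₁ := firstCols X.rank_le_width V
  ext i j
  set u : Matrix (Fin n₁) Unit 𝕜 := (lastCols X.rank U).submatrix id fun _ => i with hu
  set v : Matrix (Fin n₂) Unit 𝕜 := (lastCols X.rank V).submatrix id fun _ => j with hv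
  have huX : uᴴ * X = 0 := by
    ext a b
    exact congrFun (congrFun (lastCols_conjTranspose_mul hX) i) b
  have hXv : X * v = 0 := by
    ext a b
    exact congrFun (congrFun (mul_lastCols hX) a) j
  -- The bordered minor of size `r + 1`. Since `uᴴX = 0`, the last row of this minor for `X + ρ D`
  -- is `ρ uᴴD[V₁ v]`. Dividing that row by `ρ` leaves `φ`, which is continuous and still vanishes
  -- when the rank is at most `r`.
  let φ : Matrix (Fin n₁) (Fin n₂) 𝕜 × Matrix (Fin n₁) (Fin n₂) 𝕜 → 𝕜 := fun z =>
    (Matrix.fromBlocks (U₁ᴴ * z.1 * V₁) (U₁ᴴ * z.1 * v) (uᴴ * z.2 * V₁) (uᴴ * z.2 * v)).det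
  have hφ : Continuous φ := by
    refine Continuous.matrix_det (Continuous.matrix_fromBlocks ?_ ?_ ?_ ?_)
    · exact (continuous_const.matrix_mul continuous_fst).matrix_mul continuous_const
    · exact (continuous_const.matrix_mul continuous_fst).matrix_mul continuous_const
    · exact (continuous_const.matrix_mul continuous_snd).matrix_mul continuous_const
    · exact (continuous_const.matrix_mul continuous_snd).matrix_mul continuous_const
  have hφ0 : ∀ j, φ (X + ρ j • D j, D j) = 0 := by
    intro j
    set Y := X + ρ j • D j with hY
    have h1 : (Matrix.fromRows U₁ᴴ uᴴ * Y * Matrix.fromCols V₁ v).det = 0 := by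
      by_contra h
      have h2 := Matrix.rank_of_isUnit _
        ((Matrix.isUnit_iff_isUnit_det _).2 (isUnit_iff_ne_zero.2 h))
      have h3 := (Matrix.rank_mul_le_left (Matrix.fromRows U₁ᴴ uᴴ * Y)
        (Matrix.fromCols V₁ v)).trans (Matrix.rank_mul_le_right _ Y)
      have h4 : Y.rank ≤ X.rank := hrank j
      rw [h2, Fintype.card_sum, Fintype.card_fin, Fintype.card_unit] at h3
      omega
    have h5 : uᴴ * Y = ((ρ j : ℝ) : 𝕜) • (uᴴ * D j) := by
      rw [hY, Matrix.mul_add, huX, zero_add, Matrix.mul_smul]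
      ext a b
      simp [RCLike.real_smul_eq_coe_mul]
    have h6 : Matrix.fromRows U₁ᴴ uᴴ * Y * Matrix.fromCols V₁ v =
        Matrix.fromBlocks 1 0 0 (((ρ j : ℝ) : 𝕜) • (1 : Matrix Unit Unit 𝕜)) *
          Matrix.fromBlocks (U₁ᴴ * Y * V₁) (U₁ᴴ * Y * v) (uᴴ * D j * V₁) (uᴴ * D j * v) := by
      rw [Matrix.fromRows_mul, Matrix.fromRows_mul_fromCols, h5, Matrix.fromBlocks_multiply]
      simp
    rw [h6, Matrix.det_mul, Matrix.det_fromBlocks_zero₁₂] at h1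
    refine (mul_eq_zero.1 h1).resolve_left ?_
    simp [(hρ j).ne']
  have hlim : Tendsto (fun j => φ (X + ρ j • D j, D j)) l (𝓝 (φ (X, D'))) := by
    refine (hφ.tendsto _).comp (Tendsto.prodMk_nhds ?_ hD)
    simpa using (tendsto_const_nhds (x := X)).add (hρ0.smul hD)
  simp only [hφ0] at hlim
  have h0 : φ (X, D') = 0 := (tendsto_nhds_unique hlim tendsto_const_nhds)
  simp only [φ] at h0
  -- In the limit `Xv = 0` makes the matrix block triangular, so the minor is `det (U₁ᴴXV₁)` times
  -- the sought entry.
  rw [Matrix.mul_assoc U₁ᴴ X v, hXv, Matrix.mul_zero, Matrix.det_fromBlocks_zero₁₂] at h0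
  have h1 := (mul_eq_zero.1 h0).resolve_left (det_firstCols_ne_zero hX)
  rw [Matrix.det_unique] at h1
  exact h1

/-! ### Passage to the limit along an ultrafilter. -/

theorem Qdagger_add (Θ : Fin d → Matrix (Fin n₁) (Fin n₂) 𝕜) (p : Fin d → ℝ)
    (β : Finset (Fin d)) (X Y : Matrix (Fin n₁) (Fin n₂) 𝕜) :
    Qdagger Θ p β (X + Y) = Qdagger Θ p β X + Qdagger Θ p β Y := by
  simp only [Qdagger, trInner_add_right, mul_add, add_smul, Finset.sum_add_distrib]

theorem tendsto_mul_zero_of_abs_le {ι : Type*} {l : Filter ι} {M : ℝ} {g x : ι → ℝ}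
    (hg : ∀ j, |g j| ≤ M) (hx : Tendsto x l (𝓝 0)) : Tendsto (fun j => g j * x j) l (𝓝 0) := by
  refine squeeze_zero_norm (fun j => ?_) (by simpa using (hx.abs.const_mul M))
  rw [Real.norm_eq_abs, abs_mul]
  exact mul_le_mul_of_nonneg_right (hg j) (abs_nonneg _)

theorem tendsto_trInner {ι : Type*} {l : Filter ι} {f g : ι → Matrix (Fin n₁) (Fin n₂) 𝕜}
    {A B : Matrix (Fin n₁) (Fin n₂) 𝕜} (hf : Tendsto f l (𝓝 A)) (hg : Tendsto g l (𝓝 B)) :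
    Tendsto (fun j => trInner (f j) (g j)) l (𝓝 (trInner A B)) := by
  have h1 : Continuous fun Z : Matrix (Fin n₁) (Fin n₂) 𝕜 × Matrix (Fin n₁) (Fin n₂) 𝕜 =>
      RCLike.re (Z.1ᴴ * Z.2).trace := RCLike.continuous_re.comp
    ((continuous_fst.matrix_conjTranspose.matrix_mul continuous_snd).matrix_trace)
  have h2 := (h1.tendsto (A, B)).comp (hf.prodMk_nhds hg)
  simp only [trInner]
  exact h2

theorem exists_tendsto_contraction {ι : Type*} (l : Ultrafilter ι)
    {W : ι → Matrix (Fin n₁) (Fin n₂) 𝕜} (hW : ∀ j, specNorm (W j) ≤ 1) :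
    ∃ W' : Matrix (Fin n₁) (Fin n₂) 𝕜, specNorm W' ≤ 1 ∧ Tendsto W l (𝓝 W') := by
  have hK : IsCompact (Set.pi Set.univ fun _ : Fin n₁ => Set.pi Set.univ fun _ : Fin n₂ =>
      Metric.closedBall (0 : 𝕜) 1) :=
    isCompact_univ_pi fun _ => isCompact_univ_pi fun _ => isCompact_closedBall _ _
  obtain ⟨W', -, hW'⟩ := hK.ultrafilter_le_nhds (l.map W) (by
    rw [le_principal_iff]
    refine Ultrafilter.mem_map.2 (Filter.univ_mem' fun j a _ b _ => ?_)
    simpa using norm_entry_le_one (hW j) a b)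
  refine ⟨W', specNorm_le_one_of_trInner_le_nucNorm fun X => ?_, hW'⟩
  have h : Tendsto (fun j => trInner (W j) X) l (𝓝 (trInner W' X)) :=
    tendsto_trInner hW' tendsto_const_nhds
  exact le_of_tendsto' h fun j => trInner_le_nucNorm (hW j) X

/-- The deterministic core: `a` stands for the sampling frequencies, `b` for the normalized noise
sums, and `heq` for the optimality condition in coordinates. An ultrafilter makes `W` converge
without extracting a subsequence. -/
theorem exists_contraction_of_tendsto {ι : Type*} (l : Ultrafilter ι) (S : MatrixSpace n₁ n₂)
    {Θ : Fin d → Matrix (Fin n₁) (Fin n₂) 𝕜} (hΘ : IsOrthonormalBasisOf (S.toSubmodule 𝕜) Θ)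
    {Xbar : Matrix (Fin n₁) (Fin n₂) 𝕜} (hXbar : Xbar ∈ S.toSubmodule 𝕜) {α : Finset (Fin d)}
    {p : Fin d → ℝ} (hp : ∀ k ∈ αᶜ, 0 < p k) {ν M : ℝ} {a b : ι → Fin d → ℝ} {ρ γ : ι → ℝ}
    {F : Matrix (Fin n₁) (Fin n₂) 𝕜} {G Xtil X W : ι → Matrix (Fin n₁) (Fin n₂) 𝕜}
    (hρ : ∀ j, 0 < ρ j) (hρ0 : Tendsto ρ l (𝓝 0)) (hγ : ∀ j, |γ j| ≤ M)
    (ha : ∀ k, Tendsto (fun j => a j k) l (𝓝 (p k)))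
    (hb : ∀ k, Tendsto (fun j => b j k) l (𝓝 0))
    (hG : Tendsto G l (𝓝 F)) (hXtil : Tendsto Xtil l (𝓝 Xbar))
    (hX : ∀ j, X j ∈ rcsFeasible (S.toSubmodule 𝕜) Θ α Xbar)
    (hrank : ∀ j, (X j).rank = Xbar.rank) (hW : ∀ j, specNorm (W j) ≤ 1)
    (hWX : ∀ j, trInner (W j) (X j) = nucNorm (X j))
    (heq : ∀ j, ∀ k ∈ αᶜ, (a j k + ρ j * γ j) * (trInner (Θ k) (X j - Xbar) / ρ j) =
      ν * b j k - trInner (W j) (Θ k) + trInner (G j) (Θ k) -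
        γ j * trInner (Xbar - Xtil j) (Θ k))
    {U : Matrix (Fin n₁) (Fin n₁) 𝕜} {V : Matrix (Fin n₂) (Fin n₂) 𝕜} (hsvd : IsSVD Xbar U V) :
    ∃ Γ ∈ S.reducedSpace Xbar.rank U V,
      (lastCols Xbar.rank U)ᴴ *
          Qdagger Θ p αᶜ (lastCols Xbar.rank U * Γ * (lastCols Xbar.rank V)ᴴ) *
          lastCols Xbar.rank V =
        (lastCols Xbar.rank U)ᴴ *
          Qdagger Θ p αᶜ (leadingPart Xbar U V - F) *
          lastCols Xbar.rank V ∧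
      specNorm Γ ≤ 1 := by
  obtain ⟨W₀, hW₀, hWlim⟩ := exists_tendsto_contraction l hW
  have hlimW : ∀ Y, Tendsto (fun j => trInner (W j) Y) l (𝓝 (trInner W₀ Y)) := fun Y =>
    tendsto_trInner hWlim tendsto_const_nhds
  have hlimG : ∀ Y, Tendsto (fun j => trInner (G j) Y) l (𝓝 (trInner F Y)) := fun Y =>
    tendsto_trInner hG tendsto_const_nhds
  have hlimXt : ∀ Y, Tendsto (fun j => trInner (Xbar - Xtil j) Y) l (𝓝 0) := fun Y => by
    have h := tendsto_trInner hXtil (tendsto_const_nhds (x := Y))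
    have h2 := (tendsto_const_nhds (x := trInner Xbar Y)).sub h
    rw [sub_self] at h2
    refine h2.congr fun j => ?_
    exact (trInner_sub_left _ _ _).symm
  have hδ : ∀ k ∈ αᶜ, Tendsto (fun j => trInner (Θ k) (X j - Xbar) / ρ j) l
      (𝓝 (1 / p k * trInner (Θ k) (F - W₀))) := by
    intro k hk
    have h1 : Tendsto (fun j => a j k + ρ j * γ j) l (𝓝 (p k)) := by
      have := (ha k).add (tendsto_mul_zero_of_abs_le hγ hρ0)
      rw [add_zero] at this
      exact this.congr fun j => by rw [mul_comm (γ j)]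
    have h2 : Tendsto (fun j => ν * b j k - trInner (W j) (Θ k) + trInner (G j) (Θ k) -
        γ j * trInner (Xbar - Xtil j) (Θ k)) l
        (𝓝 (ν * 0 - trInner W₀ (Θ k) + trInner F (Θ k) - 0)) :=
      ((((hb k).const_mul ν).sub (hlimW (Θ k))).add (hlimG (Θ k))).sub
        (tendsto_mul_zero_of_abs_le hγ (hlimXt (Θ k)))
    have h3 := h2.div h1 (hp k hk).ne'
    have h4 : (ν * 0 - trInner W₀ (Θ k) + trInner F (Θ k) - 0) / p k =
        1 / p k * trInner (Θ k) (F - W₀) := by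
      rw [trInner_sub_right, trInner_comm (Θ k), trInner_comm (Θ k)]
      ring
    rw [← h4]
    refine h3.congr' ?_
    -- The coefficient of the rescaled error is only eventually nonzero.
    filter_upwards [h1.eventually_ne (hp k hk).ne'] with j hj
    simp only [Pi.div_apply]
    rw [← heq j k hk, mul_div_cancel_left₀ _ hj]
  set D : ι → Matrix (Fin n₁) (Fin n₂) 𝕜 := fun j =>
    ∑ k ∈ αᶜ, (trInner (Θ k) (X j - Xbar) / ρ j) • Θ k with hDdef
  have hD : Tendsto D l (𝓝 (Qdagger Θ p αᶜ (F - W₀))) :=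
    tendsto_finsetSum _ fun k hk => (hδ k hk).smul_const (Θ k)
  have hXD : ∀ j, X j = Xbar + ρ j • D j := by
    intro j
    have h1 := hΘ.sum_repr (Submodule.sub_mem _ (hX j).1 hXbar)
    rw [← Finset.sum_add_sum_compl α, Finset.sum_eq_zero, zero_add] at h1
    · rw [hDdef]
      simp only [Finset.smul_sum, smul_smul, mul_div_cancel₀ _ (hρ j).ne']
      rw [h1, add_sub_cancel]
    · intro k hk
      rw [trInner_sub_right, (hX j).2 k hk, sub_self, zero_smul]
  have hblock := block_eq_zero_of_rank_le hsvd hρ hρ0 hD fun j => by rw [← hXD, hrank]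
  have hXlim : Tendsto X l (𝓝 Xbar) := by
    have h1 := (tendsto_const_nhds (x := Xbar)).add (hρ0.smul hD)
    rw [zero_smul, add_zero] at h1
    exact h1.congr fun j => (hXD j).symm
  -- Subgradients are closed under limits: compare with a contraction `Z` that attains the norm at
  -- `Xbar`.
  have hW₀X : trInner W₀ Xbar = nucNorm Xbar := by
    refine le_antisymm (trInner_le_nucNorm hW₀ _) ?_
    obtain ⟨Z, hZ, hZX⟩ := exists_trInner_eq_nucNorm Xbar
    rw [← hZX]
    have h1 : Tendsto (fun j => trInner Z (X j)) l (𝓝 (trInner Z Xbar)) :=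
      tendsto_trInner tendsto_const_nhds hXlim
    have h2 : Tendsto (fun j => trInner (W j) (X j)) l (𝓝 (trInner W₀ Xbar)) :=
      tendsto_trInner hWlim hXlim
    refine le_of_tendsto_of_tendsto' h1 h2 fun j => ?_
    rw [hWX]
    exact trInner_le_nucNorm hZ _
  obtain ⟨W', hW'S, hW', hW'eq⟩ := exists_mem_contraction S hW₀
  have hdecomp := subgradient_eq_leadingPart_add hsvd hW' ((hW'eq _ hXbar).trans hW₀X)
  set U₂ := lastCols Xbar.rank U
  set V₂ := lastCols Xbar.rank V
  have hΓ : U₂ * -(U₂ᴴ * W' * V₂) * V₂ᴴ = leadingPart Xbar U V - W' := by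
    nth_rw 2 [hdecomp]
    rw [Matrix.mul_neg, Matrix.neg_mul]
    abel
  -- With this sign `U₂ΓV₂ᴴ = U₁V₁ᴴ - W'`, and the two sides of the system differ by the block of
  -- `𝒬†(F - W')`, which is zero by `hblock`.
  refine ⟨-(U₂ᴴ * W' * V₂), ?_, ?_, ?_⟩
  · change U₂ * -(U₂ᴴ * W' * V₂) * V₂ᴴ ∈ S.toSubmodule 𝕜
    rw [hΓ]
    exact Submodule.sub_mem _ (leadingPart_mem S hXbar hsvd) hW'S
  · have h1 : Qdagger Θ p αᶜ (F - W') = Qdagger Θ p αᶜ (F - W₀) := by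
      refine Finset.sum_congr rfl fun k _ => ?_
      rw [trInner_sub_right, trInner_sub_right, trInner_comm _ W', trInner_comm _ W₀,
        hW'eq _ (hΘ.mem k)]
    have h2 : leadingPart Xbar U V - W' = (leadingPart Xbar U V - F) + (F - W') := by abel
    rw [hΓ, h2, Qdagger_add, h1, Matrix.mul_add, Matrix.add_mul, hblock, add_zero]
  · rw [specNorm_neg]
    exact specNorm_mul_le_one (specNorm_mul_le_one
      (specNorm_conjTranspose_le_one (specNorm_lastCols _ hsvd.1)) hW') (specNorm_lastCols _ hsvd.2.1)

end

section

variable {Ω : Type*} [MeasurableSpace Ω] {P : Measure Ω}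

/-! ### Laws of large numbers -/

/-- Chebyshev's inequality, with each variance bounded by the second moment. -/
theorem measure_sum_sub_ge_le [IsProbabilityMeasure P] {Z : ℕ → Ω → ℝ} {μ : ℝ}
    (hZ : ∀ i, MemLp (Z i) 2 P)
    (hindep : iIndepFun Z P) (hmean : ∀ i, ∫ ω, Z i ω ∂P = μ)
    (hsq : ∀ i, ∫ ω, Z i ω ^ 2 ∂P ≤ 1) (m : ℕ) {c : ℝ} (hc : 0 < c) :
    P {ω | c ≤ |∑ i ∈ Finset.range m, Z i ω - m * μ|} ≤ ENNReal.ofReal (m / c ^ 2) := by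
  have h1 : MemLp (∑ i ∈ Finset.range m, Z i) 2 P := memLp_finsetSum' _ fun i _ => hZ i
  have h2 : P[∑ i ∈ Finset.range m, Z i] = m * μ := by
    simp only [Finset.sum_apply]
    rw [integral_finsetSum _ fun i _ => (hZ i).integrable one_le_two]
    simp [hmean]
  have h3 : variance (∑ i ∈ Finset.range m, Z i) P ≤ m := by
    rw [IndepFun.variance_sum (fun i _ => hZ i) fun i _ j _ hij => hindep.indepFun hij]
    calc ∑ i ∈ Finset.range m, variance (Z i) P ≤ ∑ i ∈ Finset.range m, (1 : ℝ) :=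
          Finset.sum_le_sum fun i _ =>
            (variance_le_expectation_sq (hZ i).aestronglyMeasurable).trans (hsq i)
      _ = m := by simp
  have h4 := meas_ge_le_variance_div_sq h1 hc
  rw [h2] at h4
  simp only [Finset.sum_apply] at h4
  exact h4.trans (ENNReal.ofReal_le_ofReal (by gcongr))

variable {d : ℕ} {p : Fin d → ℝ} {idx : ℕ → Ω → Fin d} {ξ : ℕ → Ω → ℝ}

/-- A constant `g` gives the frequency counts, the identity gives the noise sums. -/
theorem iIndepFun_ite (hindep : iIndepFun (fun i ω => (idx i ω, ξ i ω)) P) (k : Fin d)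
    {g : ℝ → ℝ} (hg : Measurable g) :
    iIndepFun (fun i ω => if idx i ω = k then g (ξ i ω) else 0) P :=
  hindep.comp (fun _ z => if z.1 = k then g z.2 else 0) fun _ =>
    Measurable.ite (measurable_fst (measurableSet_singleton k)) (hg.comp measurable_snd)
      measurable_const

theorem tendsto_frequency [IsProbabilityMeasure P]
    (hidx_meas : ∀ i, Measurable (idx i))
    (hidx_law : ∀ i k, P.real {ω | idx i ω = k} = p k)
    (hindep : iIndepFun (fun i ω => (idx i ω, ξ i ω)) P) (k : Fin d) {ε : ℝ} (hε : 0 < ε) :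
    Tendsto (fun m : ℕ => P {ω | ε ≤
      |(∑ i ∈ Finset.range m, if idx i ω = k then (1 : ℝ) else 0) / m - p k|}) atTop (𝓝 0) := by
  have hset : ∀ i, MeasurableSet {ω | idx i ω = k} := fun i =>
    hidx_meas i (measurableSet_singleton k)
  have hmeas : ∀ i, Measurable fun ω => if idx i ω = k then (1 : ℝ) else 0 := fun i =>
    Measurable.ite (hset i) measurable_const measurable_const
  have hint : ∀ i, ∫ ω, (if idx i ω = k then (1 : ℝ) else 0) ∂P = p k := fun i => by
    rw [← hidx_law i k, ← integral_indicator_one (hset i)]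
    simp [Set.indicator_apply]
  have hbound := measure_sum_sub_ge_le (P := P) (μ := p k)
    (Z := fun i ω => if idx i ω = k then (1 : ℝ) else 0)
    (fun i => MemLp.of_bound (hmeas i).aestronglyMeasurable 1
      (ae_of_all _ fun ω => by split_ifs <;> simp))
    (iIndepFun_ite hindep k measurable_const) hint
    (fun i => by
      simp only [ite_pow, one_pow, ne_eq, OfNat.ofNat_ne_zero, not_false_eq_true, zero_pow]
      rw [hint, ← hidx_law i k]
      exact measureReal_le_one)
  have hlim : Tendsto (fun m : ℕ => ENNReal.ofReal (ε⁻¹ ^ 2 * (1 / (m : ℝ)))) atTop (𝓝 0) := by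
    have := (tendsto_one_div_atTop_nhds_zero_nat (𝕜 := ℝ)).const_mul (ε⁻¹ ^ 2)
    rw [mul_zero] at this
    simpa using ENNReal.tendsto_ofReal this
  refine tendsto_of_tendsto_of_tendsto_of_le_of_le' tendsto_const_nhds hlim
    (Eventually.of_forall fun _ => zero_le) ?_
  filter_upwards [eventually_ge_atTop 1] with m hm
  have hm' : (0 : ℝ) < m := by exact_mod_cast hm
  have h1 := hbound m (c := m * ε) (by positivity)
  refine (measure_mono fun ω hω => ?_).trans (h1.trans (ENNReal.ofReal_le_ofReal (le_of_eq ?_)))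
  · have h2 : (∑ i ∈ Finset.range m, if idx i ω = k then (1 : ℝ) else 0) - m * p k =
        m * ((∑ i ∈ Finset.range m, if idx i ω = k then (1 : ℝ) else 0) / m - p k) := by
      field_simp
    change m * ε ≤ |_|
    rw [h2, abs_mul, abs_of_pos hm']
    exact mul_le_mul_of_nonneg_left hω hm'.le
  · field_simp

theorem tendsto_noise [IsProbabilityMeasure P]
    (hidx_meas : ∀ i, Measurable (idx i)) (hξ_meas : ∀ i, Measurable (ξ i))
    (hξ_ident : ∀ i, IdentDistrib (ξ i) (ξ 0) P P)
    (hξ_L2 : MemLp (ξ 0) 2 P) (hξ_mean : ∫ ω, ξ 0 ω ∂P = 0) (hξ_var : ∫ ω, ξ 0 ω ^ 2 ∂P = 1)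
    (hindep : iIndepFun (fun i ω => (idx i ω, ξ i ω)) P)
    (hindep' : ∀ i, IndepFun (idx i) (ξ i) P) {ρ : ℕ → ℝ} (hρ_pos : ∀ m, 0 < ρ m)
    (hρ_slow : Tendsto (fun m : ℕ => Real.sqrt m * ρ m) atTop atTop) (k : Fin d)
    {ε : ℝ} (hε : 0 < ε) :
    Tendsto (fun m : ℕ => P {ω | ε ≤
      |(∑ i ∈ Finset.range m, if idx i ω = k then ξ i ω else 0) / (m * ρ m)|}) atTop (𝓝 0) := by
  have hset : ∀ i, MeasurableSet {ω | idx i ω = k} := fun i =>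
    hidx_meas i (measurableSet_singleton k)
  have hmeas : ∀ i, Measurable fun ω => if idx i ω = k then ξ i ω else 0 := fun i =>
    Measurable.ite (hset i) (hξ_meas i) measurable_const
  have hξi : ∀ i, MemLp (ξ i) 2 P := fun i => (hξ_ident i).symm.memLp_snd hξ_L2
  have hZ : ∀ i, MemLp (fun ω => if idx i ω = k then ξ i ω else 0) 2 P := fun i =>
    (hξi i).mono (hmeas i).aestronglyMeasurable (ae_of_all _ fun ω => by
      split_ifs <;> simp)
  have hint : ∀ i, ∫ ω, (if idx i ω = k then ξ i ω else 0) ∂P = 0 := fun i => by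
    -- Sampling and noise are independent, so the mean factors and is zero.
    have h1 : IndepFun (fun ω => if idx i ω = k then (1 : ℝ) else 0) (ξ i) P :=
      (hindep' i).comp (φ := fun l => if l = k then (1 : ℝ) else 0) (ψ := id)
        (measurable_of_finite _) measurable_id
    have h2 := h1.integral_fun_mul_eq_mul_integral
      (Measurable.ite (hset i) measurable_const measurable_const).aestronglyMeasurable
      (hξ_meas i).aestronglyMeasurable
    rw [(hξ_ident i).integral_eq, hξ_mean, mul_zero] at h2
    simpa using h2
  have hsq : ∀ i, ∫ ω, (if idx i ω = k then ξ i ω else 0) ^ 2 ∂P ≤ 1 := fun i => by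
    have h1 : ∫ ω, ξ i ω ^ 2 ∂P = 1 := by
      rw [← hξ_var]
      exact ((hξ_ident i).comp (u := fun x => x ^ 2) (by fun_prop)).integral_eq
    rw [← h1]
    refine integral_mono (hZ i).integrable_sq (hξi i).integrable_sq fun ω => ?_
    simp only
    split_ifs
    · exact le_rfl
    · simpa using sq_nonneg (ξ i ω)
  have hbound := measure_sum_sub_ge_le hZ (iIndepFun_ite hindep k measurable_id) hint hsq
  have hlim : Tendsto (fun m : ℕ => ENNReal.ofReal (ε⁻¹ ^ 2 * ((Real.sqrt m * ρ m)⁻¹) ^ 2)) atTop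
      (𝓝 0) := by
    have := ((tendsto_inv_atTop_zero.comp hρ_slow).pow 2).const_mul (ε⁻¹ ^ 2)
    rw [zero_pow two_ne_zero, mul_zero] at this
    simpa using ENNReal.tendsto_ofReal this
  refine tendsto_of_tendsto_of_tendsto_of_le_of_le' tendsto_const_nhds hlim
    (Eventually.of_forall fun _ => zero_le) ?_
  filter_upwards [eventually_ge_atTop 1] with m hm
  have hm' : (0 : ℝ) < m := by exact_mod_cast hm
  have hρm := hρ_pos m
  -- For this `c` the Chebyshev bound `m / c²` is `(ε √m ρ)⁻²`, which vanishes exactly because `√m ρ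
  -- → ∞`.
  have h1 := hbound m (c := m * ρ m * ε) (by positivity)
  refine (measure_mono fun ω hω => ?_).trans (h1.trans (ENNReal.ofReal_le_ofReal (le_of_eq ?_)))
  · change m * ρ m * ε ≤ |_|
    change ε ≤ |_| at hω
    rw [abs_div, abs_of_pos (mul_pos hm' hρm), le_div_iff₀ (by positivity)] at hω
    rw [mul_zero, sub_zero, mul_comm]
    exact hω
  · rw [inv_pow, inv_pow, mul_pow (√(m : ℝ)), Real.sq_sqrt hm'.le]
    field_simp

/-! ### Selecting good outcomes. -/

/-- An event of probability tending to `1` meets, for some large `m`, the complement of the union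
of an event of vanishing probability, a null event and an event of probability at most `1 / 2`
(the events need not be measurable). -/
theorem frequently_exists_mem {A B C N : ℕ → Set Ω} (hA : Tendsto (fun m => P (A m)) atTop (𝓝 1))
    (hB : Tendsto (fun m => P (B m)) atTop (𝓝 0))
    (hC : ∀ᶠ m in atTop, P (C m) ≤ ENNReal.ofReal (1 / 2)) (hN : ∀ᶠ m in atTop, P (N m) = 0) :
    ∀ᶠ m in atTop, ∃ ω, ω ∈ A m ∧ ω ∉ B m ∧ ω ∉ C m ∧ ω ∉ N m := by
  -- Covering `A` by the three other events would give `P (A m) ≤ 1/4 + 1/2`, against `P (A m) >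
  -- 3/4`. Only subadditivity of the outer measure enters.
  have h1 : ENNReal.ofReal (3 / 4) < 1 := by
    rw [← ENNReal.ofReal_one]
    exact (ENNReal.ofReal_lt_ofReal_iff one_pos).2 (by norm_num)
  have h2 : (0 : ENNReal) < ENNReal.ofReal (1 / 4) := ENNReal.ofReal_pos.2 (by norm_num)
  filter_upwards [hA.eventually_const_lt h1, hB.eventually_lt_const h2, hC, hN]
    with m hAm hBm hCm hNm
  by_contra! h
  have h3 : A m ⊆ B m ∪ C m ∪ N m := fun ω hω => by
    by_cases hb : ω ∈ B m
    · exact Or.inl (Or.inl hb)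
    by_cases hc : ω ∈ C m
    · exact Or.inl (Or.inr hc)
    exact Or.inr (h ω hω hb hc)
  have h4 : P (A m) ≤ ENNReal.ofReal (1 / 4) + ENNReal.ofReal (1 / 2) := by
    refine (measure_mono h3).trans ((measure_union_le _ _).trans ?_)
    rw [hNm, add_zero]
    exact (measure_union_le _ _).trans (add_le_add hBm.le hCm)
  rw [← ENNReal.ofReal_add (by norm_num) (by norm_num)] at h4
  norm_num at h4 hAm
  exact absurd h4 (not_le.2 hAm)

theorem tendsto_measure_union_zero {A B : ℕ → Set Ω} (hA : Tendsto (fun m => P (A m)) atTop (𝓝 0))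
    (hB : Tendsto (fun m => P (B m)) atTop (𝓝 0)) :
    Tendsto (fun m => P (A m ∪ B m)) atTop (𝓝 0) := by
  have h := hA.add hB
  rw [add_zero] at h
  exact tendsto_of_tendsto_of_tendsto_of_le_of_le tendsto_const_nhds h (fun _ => zero_le)
    fun _ => measure_union_le _ _

theorem tendsto_measure_iUnion_zero {κ : Type*} [Fintype κ] {A : κ → ℕ → Set Ω}
    (hA : ∀ k, Tendsto (fun m => P (A k m)) atTop (𝓝 0)) :
    Tendsto (fun m => P (⋃ k, A k m)) atTop (𝓝 0) := by
  have h : Tendsto (fun m => ∑ k, P (A k m)) atTop (𝓝 (∑ _k : κ, 0)) :=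
    tendsto_finsetSum _ fun k _ => hA k
  rw [Finset.sum_const_zero] at h
  exact tendsto_of_tendsto_of_tendsto_of_le_of_le tendsto_const_nhds h (fun _ => zero_le)
    fun _ => measure_iUnion_fintype_le _ _

theorem tendsto_of_abs_sub_lt {x : ℕ → ℝ} {a : ℝ} (h : ∀ j, |x j - a| < 1 / ((j : ℝ) + 1)) :
    Tendsto x atTop (𝓝 a) := by
  rw [tendsto_iff_dist_tendsto_zero]
  exact squeeze_zero (fun _ => dist_nonneg) (fun j => (h j).le)
    tendsto_one_div_add_atTop_nhds_zero_nat

theorem tendsto_of_frobNorm_sub_lt {𝕜 : Type*} [RCLike 𝕜] {n₁ n₂ : ℕ}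
    {X : ℕ → Matrix (Fin n₁) (Fin n₂) 𝕜} {A : Matrix (Fin n₁) (Fin n₂) 𝕜}
    (h : ∀ j, frobNorm (X j - A) < 1 / ((j : ℝ) + 1)) : Tendsto X atTop (𝓝 A) := by
  refine tendsto_pi_nhds.2 fun i => tendsto_pi_nhds.2 fun k => ?_
  rw [tendsto_iff_norm_sub_tendsto_zero]
  exact squeeze_zero (fun _ => norm_nonneg _)
    (fun j => (norm_entry_le_frobNorm (X j - A) i k).trans (h j).le)
    tendsto_one_div_add_atTop_nhds_zero_nat

end

end RankCorrection

/-! ### The theorem: from random estimators to one deterministic sequence. -/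

theorem theorem4p1 {𝕜 : Type*} [RCLike 𝕜] {n₁ n₂ d : ℕ}
    -- the matrix space and its orthonormal basis
    (S : MatrixSpace n₁ n₂)
    (Θ : Fin d → Matrix (Fin n₁) (Fin n₂) 𝕜)
    (hΘ : IsOrthonormalBasisOf (S.toSubmodule 𝕜) Θ)
    -- the true matrix, and the indices of the fixed basis coefficients
    (Xbar : Matrix (Fin n₁) (Fin n₂) 𝕜) (hXbar : Xbar ∈ S.toSubmodule 𝕜)
    (hrank : 1 ≤ Xbar.rank)
    (α : Finset (Fin d))
    -- the i.i.d. sampled indices and the i.i.d. noise, independent of each other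
    {Ω : Type*} [MeasurableSpace Ω] (P : Measure Ω) [IsProbabilityMeasure P]
    (p : Fin d → ℝ) (hpα : ∀ k ∈ α, p k = 0) (hpβ : ∀ k ∈ αᶜ, 0 < p k)
    (idx : ℕ → Ω → Fin d) (ξ : ℕ → Ω → ℝ)
    (hidx_meas : ∀ i, Measurable (idx i)) (hξ_meas : ∀ i, Measurable (ξ i))
    (hidx_law : ∀ i k, P.real {ω | idx i ω = k} = p k)
    (hξ_ident : ∀ i, IdentDistrib (ξ i) (ξ 0) P P)
    (hξ_L2 : MemLp (ξ 0) 2 P) (hξ_mean : ∫ ω, ξ 0 ω ∂P = 0) (hξ_var : ∫ ω, ξ 0 ω ^ 2 ∂P = 1)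
    (hindep : iIndepFun (fun i ω => (idx i ω, ξ i ω)) P)
    (hindep' : ∀ i, IndepFun (idx i) (ξ i) P)
    (ν : ℝ) (hν : 0 < ν)
    -- the spectral operator, continuous at the true matrix
    (f : (Fin (min n₁ n₂) → ℝ) → (Fin (min n₁ n₂) → ℝ)) (hf : IsSymmetricFun f)
    (hF : ContinuousWithinAt (spectralOperator (𝕜 := 𝕜) f) (S.toSubmodule 𝕜) Xbar)
    -- the initial estimator, consistent
    (Xtil : ℕ → Ω → Matrix (Fin n₁) (Fin n₂) 𝕜)
    (hXtil_mem : ∀ m, ∀ᵐ ω ∂P, Xtil m ω ∈ S.toSubmodule 𝕜)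
    (hXtil : TendstoInProbability P Xtil Xbar)
    -- the regularization parameters
    (ρ : ℕ → ℝ) (hρ_pos : ∀ m, 0 < ρ m)
    (hρ_zero : Tendsto ρ atTop (𝓝 0))
    (hρ_slow : Tendsto (fun m : ℕ => Real.sqrt m * ρ m) atTop atTop)
    (γ : ℕ → Ω → ℝ) (hγ_nonneg : ∀ m, ∀ᵐ ω ∂P, 0 ≤ γ m ω)
    (hγ : BoundedInProbability P γ)
    -- the estimator: an optimal solution of the rank-correction step for `m` observations
    (Xhat : ℕ → Ω → Matrix (Fin n₁) (Fin n₂) 𝕜)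
    (hXhat_mem : ∀ m, 1 ≤ m → ∀ᵐ ω ∂P,
      Xhat m ω ∈ rcsFeasible (S.toSubmodule 𝕜) Θ α Xbar)
    (hXhat_min : ∀ m, 1 ≤ m → ∀ᵐ ω ∂P,
      IsMinOn
        (rcsObjective Θ m (fun i => idx i ω)
          (fun i => trInner (Θ (idx i ω)) Xbar + ν * ξ i ω)
          (ρ m) (γ m ω) (spectralOperator f (Xtil m ω)) (Xtil m ω))
        (rcsFeasible (S.toSubmodule 𝕜) Θ α Xbar) (Xhat m ω))
    (hconsistent : RankConsistent P Xhat Xbar) :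
    ∀ (U : Matrix (Fin n₁) (Fin n₁) 𝕜) (V : Matrix (Fin n₂) (Fin n₂) 𝕜), IsSVD Xbar U V →
      ∃ Γ ∈ S.reducedSpace Xbar.rank U V,
        (lastCols Xbar.rank U)ᴴ *
            Qdagger Θ p αᶜ (lastCols Xbar.rank U * Γ * (lastCols Xbar.rank V)ᴴ) *
            lastCols Xbar.rank V =
          (lastCols Xbar.rank U)ᴴ *
            Qdagger Θ p αᶜ (leadingPart Xbar U V - spectralOperator f Xbar) *
            lastCols Xbar.rank V ∧
        specNorm Γ ≤ 1 := by
  intro U V hsvd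
  -- Boundedness at level `1/2` is enough: the outcomes with `|γ| ≤ M` only have to meet an event of
  -- probability near one, and the same `M` serves every `j`.
  obtain ⟨M, hM⟩ := hγ (1 / 2) (by norm_num)
  have hgood : ∀ j : ℕ, ∃ m, j + 1 ≤ m ∧ ∃ ω, (Xhat m ω).rank = Xbar.rank ∧
      (∀ k, |(∑ i ∈ Finset.range m, if idx i ω = k then (1 : ℝ) else 0) / m - p k| <
        1 / ((j : ℝ) + 1)) ∧
      (∀ k, |(∑ i ∈ Finset.range m, if idx i ω = k then ξ i ω else 0) / (m * ρ m) - 0| <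
        1 / ((j : ℝ) + 1)) ∧
      frobNorm (Xtil m ω - Xbar) < 1 / ((j : ℝ) + 1) ∧ |γ m ω| ≤ M ∧
      Xtil m ω ∈ S.toSubmodule 𝕜 ∧ Xhat m ω ∈ rcsFeasible (S.toSubmodule 𝕜) Θ α Xbar ∧
      IsMinOn (rcsObjective Θ m (fun i => idx i ω)
        (fun i => trInner (Θ (idx i ω)) Xbar + ν * ξ i ω)
        (ρ m) (γ m ω) (spectralOperator f (Xtil m ω)) (Xtil m ω))
        (rcsFeasible (S.toSubmodule 𝕜) Θ α Xbar) (Xhat m ω) := by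
    intro j
    have hε : 0 < 1 / ((j : ℝ) + 1) := by positivity
    have hB := tendsto_measure_union_zero (tendsto_measure_union_zero
      (tendsto_measure_iUnion_zero fun k => tendsto_frequency hidx_meas hidx_law hindep k hε)
      (tendsto_measure_iUnion_zero fun k => tendsto_noise hidx_meas hξ_meas hξ_ident hξ_L2 hξ_mean
        hξ_var hindep hindep' hρ_pos hρ_slow k hε)) (hXtil _ hε)
    have hN : ∀ᶠ m in atTop, P {ω | ¬ (Xtil m ω ∈ S.toSubmodule 𝕜 ∧
        Xhat m ω ∈ rcsFeasible (S.toSubmodule 𝕜) Θ α Xbar ∧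
        IsMinOn (rcsObjective Θ m (fun i => idx i ω)
          (fun i => trInner (Θ (idx i ω)) Xbar + ν * ξ i ω)
          (ρ m) (γ m ω) (spectralOperator f (Xtil m ω)) (Xtil m ω))
          (rcsFeasible (S.toSubmodule 𝕜) Θ α Xbar) (Xhat m ω))} = 0 := by
      filter_upwards [eventually_ge_atTop 1] with m hm
      exact ae_iff.1 ((hXtil_mem m).and ((hXhat_mem m hm).and (hXhat_min m hm)))
    obtain ⟨m, ⟨ω, h1, h2, h3, h4⟩, hm⟩ := ((frequently_exists_mem hconsistent hB hM hN).and
      (eventually_ge_atTop (j + 1))).exists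
    simp only [Set.mem_union, Set.mem_iUnion, Set.mem_ofPred_eq, not_or, not_exists, not_le,
      not_lt, not_not] at h1 h2 h3 h4
    exact ⟨m, hm, ω, h1, h2.1.1, fun k => by simpa using h2.1.2 k, h2.2, h3, h4⟩
  choose m hm ω hrk ha hb hXt hγM hXtS hfeas hmin using hgood
  have hm_top : Tendsto m atTop atTop :=
    tendsto_atTop_mono (fun j => (Nat.le_succ j).trans (hm j)) tendsto_id
  choose W hW hWX hWeq using fun j =>
    exists_subgradient_coordinates hΘ (hρ_pos (m j)) (hfeas j) (hmin j)
  have hXt_lim := tendsto_of_frobNorm_sub_lt hXt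
  have hF_lim : Tendsto (fun j => spectralOperator f (Xtil (m j) (ω j))) atTop
      (𝓝 (spectralOperator f Xbar)) :=
    hF.tendsto.comp (tendsto_nhdsWithin_iff.2 ⟨hXt_lim, Eventually.of_forall hXtS⟩)
  -- A free ultrafilter refines `atTop`, so every limit along the chosen outcomes is inherited.
  have hle : ((hyperfilter ℕ : Ultrafilter ℕ) : Filter ℕ) ≤ atTop := Nat.hyperfilter_le_atTop
  exact exists_contraction_of_tendsto (hyperfilter ℕ) S hΘ hXbar hpβ
    (fun j => hρ_pos (m j)) ((hρ_zero.comp hm_top).mono_left hle) hγM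
    (fun k => (tendsto_of_abs_sub_lt fun j => ha j k).mono_left hle)
    (fun k => (tendsto_of_abs_sub_lt fun j => hb j k).mono_left hle)
    (hF_lim.mono_left hle) (hXt_lim.mono_left hle) hfeas hrk hW hWX hWeq hsvd
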